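/- **Theorem (homeomorphism guarantees for a minimum spanning tree).** *Conventions.* $d$ is the Euclidean distance of $\mathbb{R}^m$, and for $A\subseteq\mathbb{R}^m$ let $A^{\epsilon}=\{x : d(x,q)\le\epsilon \text{ for some } q\in A\}$. A *straight-line graph* is a finite graph whose vertices are points of $\mathbb{R}^m$, each edge being drawn as the line segment between its endpoints; it is identified with the union of its vertices and segments when it is regarded as a topological space. A *straight-line tree* $T$ is a straight-line graph that is a tree and in which two distinct edges meet at most in a common endpoint; $\mathbb{V}(T)$ and $\mathbb{E}(T)$ are its vertices and edges, and $\theta(T)\in(0,\pi]$ is the minimal angle between two distinct edges with a common vertex ($\theta(T)=\pi$ if there is no such pair). For a connected straight-line graph $G$, $l_{\max}(G)$ is the maximal Euclidean length of an edge ($0$ if there are no edges), and $d_G(a,b)$ is the minimal total Euclidean length of a path in $G$ from $a$ to $b$; edges of $G$ may cross. Let $T$ be a straight-line tree in $\mathbb{R}^m$ with at least one edge, and let the finite set $C\subset\mathbb{R}^m$ be an $\epsilon$-sample of $T$, i.e. $C\subseteq T^{\epsilon}$. Let $\gamma\ge 1$ and let $G$ be a $\gamma$-approximation of $(T,C)$,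 i.e. a connected straight-line graph with vertex set $C$ such that 1. $d_G(a,b)\le\gamma\, d(a,b)$ whenever $a,b\in e^{\epsilon}\cap C$ for one and the same edge $e\in\mathbb{E}(T)$; 2. $\inf\{d(x,y) : x\in e,\ y\in h\} > l_{\max}(G)+2\epsilon$ for any two edges $e,h$ of $T$ without a common endpoint. Let $D\subseteq C$ be $\delta$-sparse in the metric $d_G$, i.e. $d_G(a,b)\ge\delta$ for all distinct $a,b\in D$, and suppose that $\mathbb{V}(T)\subseteq D^{\epsilon}$ and that no point of $D$ is within distance $\epsilon$ of both endpoints of an edge of $T$. If $$\delta \;\ge\; 2\gamma\left(\epsilon+\frac{\epsilon}{\sin\left(\frac{\theta(T)}{2}\right)}+\frac{l_{\max}(G)}{\sin\left(\min\left(\theta(T),\frac{\pi}{2}\right)\right)}\right),$$ then a minimum spanning tree $\mathrm{MST}(D,d_G)$ of the finite metric space $(D,d_G)$ exists, and every such minimum spanning tree, drawn in $\mathbb{R}^m$ with straight-line edges, is homeomorphic to $T$. -/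

import Mathlib

/-!
Straight-line graphs in `ℝ^m`: a finite set of points `S` together with a simple graph on `S`,
every edge being drawn as the line segment between its endpoints.
-/

noncomputable section

namespace SLGraph

/-- Euclidean space `ℝ^m`. -/
abbrev Pt (m : ℕ) := EuclideanSpace ℝ (Fin m)

variable {m : ℕ}

/-- The closed `ε`-offset `A^ε`: all points at Euclidean distance at most `ε` from a point of `A`. -/
def offset (A : Set (Pt m)) (ε : ℝ) : Set (Pt m) :=
  {x | ∃ q ∈ A, dist x q ≤ ε}

/-- The minimal distance `d_min(A, B)`, the infimum of the distances `d(x, y)`, `x ∈ A`, `y ∈ B`. -/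
def minDist (A B : Set (Pt m)) : ℝ :=
  sInf {r | ∃ x ∈ A, ∃ y ∈ B, r = dist x y}

/-- The straight-line drawing of a graph on a finite set of points of `ℝ^m`:
its vertices together with the line segments that are its edges. -/
def drawing {S : Finset (Pt m)} (G : SimpleGraph S) : Set (Pt m) :=
  {x | x ∈ S ∨ ∃ a b : S, G.Adj a b ∧ x ∈ segment ℝ (a : Pt m) (b : Pt m)}

/-- A straight-line tree: a finite tree whose vertices are points of `ℝ^m`, such that two distinct
edges, drawn as segments, meet at most in a common endpoint. -/
structure IsStraightLineTree {S : Finset (Pt m)} (T : SimpleGraph S) : Prop where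
  isTree : T.IsTree
  embedded : ∀ a b c d : S, T.Adj a b → T.Adj c d → s(a, b) ≠ s(c, d) →
    ∀ x ∈ segment ℝ (a : Pt m) (b : Pt m), x ∈ segment ℝ (c : Pt m) (d : Pt m) →
      (x = a ∨ x = b) ∧ (x = c ∨ x = d)

/-- The minimal angle `θ(T)` between two distinct edges with a common vertex. Angles lie in
`[0, π]`, and the value is `π` if there is no such pair of edges. -/
def minAngle {S : Finset (Pt m)} (T : SimpleGraph S) : ℝ :=
  sInf ({Real.pi} ∪ {φ | ∃ v a b : S, T.Adj v a ∧ T.Adj v b ∧ a ≠ b ∧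
    φ = EuclideanGeometry.angle (a : Pt m) (v : Pt m) (b : Pt m)})

/-- The maximal Euclidean length of an edge, `l_max(G)` (`0` if there are no edges). -/
def maxEdgeLength {S : Finset (Pt m)} (G : SimpleGraph S) : ℝ :=
  sSup {r | ∃ a b : S, G.Adj a b ∧ r = dist (a : Pt m) (b : Pt m)}

/-- The Euclidean length of a walk. -/
def walkLength {S : Finset (Pt m)} {G : SimpleGraph S} {a b : S} (p : G.Walk a b) : ℝ :=
  (p.darts.map fun e => dist (e.fst : Pt m) (e.snd : Pt m)).sum

/-- The path metric `d_G` of a connected straight-line graph: the least length of a walk. -/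
def pathDist {S : Finset (Pt m)} (G : SimpleGraph S) (a b : S) : ℝ :=
  ⨅ p : G.Walk a b, walkLength p

/-- `C` is an `ε`-sample of the straight-line graph `T`. -/
def IsSample {V : Finset (Pt m)} (T : SimpleGraph V) (C : Finset (Pt m)) (ε : ℝ) : Prop :=
  (C : Set (Pt m)) ⊆ offset (drawing T) ε

/-- `G` is a `γ`-approximation of `(T, C)`, where `C` is an `ε`-sample of `T`. -/
structure IsApproximation {V C : Finset (Pt m)} (T : SimpleGraph V) (ε γ : ℝ)
    (G : SimpleGraph C) : Prop where
  connected : G.Connected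
  pathDist_le : ∀ u v : V, T.Adj u v → ∀ a b : C,
    (a : Pt m) ∈ offset (segment ℝ (u : Pt m) (v : Pt m)) ε →
    (b : Pt m) ∈ offset (segment ℝ (u : Pt m) (v : Pt m)) ε →
    pathDist G a b ≤ γ * dist (a : Pt m) (b : Pt m)
  lt_minDist : ∀ u v u' v' : V, T.Adj u v → T.Adj u' v' →
    u ≠ u' → u ≠ v' → v ≠ u' → v ≠ v' →
    maxEdgeLength G + 2 * ε <
      minDist (segment ℝ (u : Pt m) (v : Pt m)) (segment ℝ (u' : Pt m) (v' : Pt m))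

/-- A `δ`-sparse set with respect to a distance function: distinct points are at distance at
least `δ`. -/
def IsSparse {X : Type*} (d : X → X → ℝ) (δ : ℝ) : Prop :=
  ∀ a b : X, a ≠ b → δ ≤ d a b

open Classical in
/-- The total weight of a graph on a finite set with symmetric weights `d`;
each edge is counted in both directions, whence the factor `1/2`. -/
def weight {X : Type*} [Fintype X] (d : X → X → ℝ) (W : SimpleGraph X) : ℝ :=
  (1 / 2) * ∑ a : X, ∑ b : X, if W.Adj a b then d a b else 0

/-- `W` is a minimum spanning tree of the finite set `X` with distance `d`. -/
def IsMST {X : Type*} [Fintype X] (d : X → X → ℝ) (W : SimpleGraph X) : Prop :=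
  W.IsTree ∧ ∀ W' : SimpleGraph X, W'.IsTree → weight d W ≤ weight d W'

/-- The path metric `d_G` of a graph `G` with vertex set `C`, restricted to a subset `D ⊆ C`. -/
def pathDistOn {C D : Finset (Pt m)} (G : SimpleGraph C) (hDC : D ⊆ C) (a b : D) : ℝ :=
  pathDist G ⟨a, hDC a.2⟩ ⟨b, hDC b.2⟩

end SLGraph

end

/-!
Call the point of `D` within `ε` of a vertex of `T` the *mark* of that vertex, and let `R` be
`cornerRadius`, so that the hypothesis on `δ` reads `δ ≥ 2 γ (ε + R)`. Since `d_G ≤ γ d` near an edge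
of `T`, distinct points of `D` near the same edge are at Euclidean distance at least `2 (ε + R)`,
hence their projections to the edge are at distance at least `2 R`
(`IsSparseModel.le_abs_coord_sub`). So marks are unique, the points of `D` near an edge are linearly
ordered along it, and the marks of the two ends come first and last. The angle condition enters
through a planar estimate (`norm_le_of_near_rays`): a point near two edges of `T`, or an edge of `G`
that jumps from one edge of `T` to another, is within `R` of a common vertex of these two edges.

The tree minus an edge has two sides, so each point of the sample has a `height` along that edge. If
the height of a point `p` of `D` near the edge lies strictly between those of `a` and `b`, then every
path in `G` from `a` to `b` uses an edge that passes `p`, both ends of which are within `δ / 2` of `p`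
in `d_G` (`IsSparseModel.pathDist_le_half_of_height`). Since that edge of `G` has positive length, `p`
is strictly closer to `a` and to `b` than they are to each other, and the exchange property of minimum
spanning trees (`IsMST.not_lt_and_lt`) shows that `a b` is not an edge of one. Consequently every edge
of a minimum spanning tree joins two points that are consecutive along an edge of `T`.

This has two consequences. The spanning tree drawn in `ℝ^m` has no crossings
(`IsSparseModel.isEmbeddedBy_coe`): two of its edges along distinct edges of `T` can only meet near a
common vertex, thus both start at its mark, and if they overlapped, the end of the shorter one would be
near both edges of `T`. And moving the points of `D` to `T` by rescaled projection, which takes marks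
to vertices, turns the drawing of the spanning tree into a subdivision of `T`
(`IsSparseModel.isEmbeddedBy_placement`, `IsSparseModel.edgeUnion_placement`). Two crossing-free
straight-line realizations of one graph are homeomorphic (`nonempty_homeomorph_edgeUnion`).
-/

noncomputable section

namespace SLGraph

/-! ### The corner between two edges -/

section Corner

open InnerProductGeometry

lemma sin_obtuse_corner {θ A B : ℝ} (hθ : Real.pi / 2 ≤ θ) (hθ' : θ ≤ Real.pi)
    (hA : A ≤ Real.pi / 2) (hB : B ≤ Real.pi / 2) (hAB : A ≤ B) (h : θ ≤ A + B) :
    Real.sin (θ / 2) ≤ Real.sin A * (1 - Real.sin (θ / 2)) + Real.sin (θ / 2) * Real.sin B := by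
  have hpi := Real.pi_pos
  obtain ⟨η, rfl⟩ : ∃ η, θ = 2 * η := ⟨θ / 2, by ring⟩
  obtain ⟨τ, rfl⟩ : ∃ τ, B = η + τ := ⟨B - η, by ring⟩
  have e : 2 * η / 2 = η := by ring
  rw [e]
  have h1 : Real.sin (η - τ) ≤ Real.sin A :=
    Real.sin_le_sin_of_le_of_le_pi_div_two (by linarith) hA (by linarith)
  have hS0 : 0 ≤ Real.sin τ := Real.sin_nonneg_of_nonneg_of_le_pi (by linarith) (by linarith)
  have hSk : Real.sin τ ≤ Real.cos η := by
    rw [← Real.sin_pi_div_two_sub]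
    exact Real.sin_le_sin_of_le_of_le_pi_div_two (by linarith) (by linarith) (by linarith)
  have hCs : Real.sin η ≤ Real.cos τ := by
    rw [← Real.cos_pi_div_two_sub]
    exact Real.cos_le_cos_of_nonneg_of_le_pi (by linarith) (by linarith) (by linarith)
  have hs0 : 0 ≤ Real.sin η := Real.sin_nonneg_of_nonneg_of_le_pi (by linarith) (by linarith)
  have hks : Real.cos η ≤ Real.sin η := by
    rw [← Real.sin_pi_div_two_sub]
    exact Real.sin_le_sin_of_le_of_le_pi_div_two (by linarith) (by linarith) (by linarith)
  have hs1 := Real.sin_le_one η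
  have hc1 := Real.cos_le_one τ
  have p1 := Real.sin_sq_add_cos_sq η
  have p2 := Real.sin_sq_add_cos_sq τ
  have h2 : Real.sin (η - τ) * (1 - Real.sin η) ≤ Real.sin A * (1 - Real.sin η) :=
    mul_le_mul_of_nonneg_right h1 (by linarith)
  rw [Real.sin_add]
  rw [Real.sin_sub] at h2
  generalize Real.sin η = s at *
  generalize Real.cos η = k at *
  generalize Real.sin τ = S at *
  generalize Real.cos τ = C at *
  have hk0 : 0 ≤ k := hS0.trans hSk
  have h2s : 1 ≤ 2 * s ^ 2 := by nlinarith
  have h2s' : 0 ≤ 2 * s - 1 := by nlinarith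
  have h3 : S ^ 2 * (2 * s - 1) ≤ k * S * (2 * s - 1) :=
    mul_le_mul_of_nonneg_right (by nlinarith) h2s'
  have h4 : (1 - C) * s ≤ (1 - C) * ((1 + C) * (2 * s - 1)) :=
    mul_le_mul_of_nonneg_left (by nlinarith) (by linarith)
  nlinarith

lemma sin_acute_corner {θ A B : ℝ} (hθ0 : 0 < θ) (hθ : θ ≤ Real.pi / 2)
    (hA : A ≤ Real.pi / 2) (hB : B ≤ θ) (hAB : A ≤ B) (h : θ ≤ A + B) :
    Real.sin θ ≤ Real.sin A * (2 * Real.cos (θ / 2) - 1) + Real.sin B := by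
  have hpi := Real.pi_pos
  obtain ⟨η, rfl⟩ : ∃ η, θ = 4 * η := ⟨θ / 4, by ring⟩
  obtain ⟨τ, rfl⟩ : ∃ τ, B = 2 * η + 2 * τ := ⟨(B - 2 * η) / 2, by ring⟩
  have e : 4 * η / 2 = 2 * η := by ring
  rw [e]
  have h1 : Real.sin (2 * η - 2 * τ) ≤ Real.sin A :=
    Real.sin_le_sin_of_le_of_le_pi_div_two (by linarith) hA (by linarith)
  have hk : 0 ≤ 2 * Real.cos (2 * η) - 1 := by
    have : Real.cos (Real.pi / 3) ≤ Real.cos (2 * η) :=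
      Real.cos_le_cos_of_nonneg_of_le_pi (by linarith) (by linarith) (by linarith)
    rw [Real.cos_pi_div_three] at this
    linarith
  have h2 := mul_le_mul_of_nonneg_right h1 hk
  have s1 : 0 ≤ Real.sin η := Real.sin_nonneg_of_nonneg_of_le_pi (by linarith) (by linarith)
  have s2 : 0 ≤ Real.sin τ := Real.sin_nonneg_of_nonneg_of_le_pi (by linarith) (by linarith)
  have s3 : 0 ≤ Real.sin (η - τ) :=
    Real.sin_nonneg_of_nonneg_of_le_pi (by linarith) (by linarith)
  -- `sin (2η - 2τ) (2 cos 2η - 1) + sin (2η + 2τ) - sin 4η` is this product of sines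
  have s4 : 0 ≤ 2 * Real.cos (2 * η) *
      (4 * (Real.sin η * (Real.sin τ * Real.sin (η - τ)))) := by
    have := mul_nonneg s1 (mul_nonneg s2 s3)
    have : 0 ≤ Real.cos (2 * η) := by linarith
    positivity
  have e4 : Real.sin (4 * η) = 2 * Real.sin (2 * η) * Real.cos (2 * η) := by
    rw [← Real.sin_two_mul]; congr 1; ring
  rw [e4, Real.sin_add]
  rw [Real.sin_sub] at h2 s4
  rw [Real.sin_two_mul τ, Real.cos_two_mul τ] at *
  rw [Real.sin_two_mul η] at *
  have p1 := Real.sin_sq_add_cos_sq η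
  have p2 := Real.sin_sq_add_cos_sq τ
  have hC : Real.cos (2 * η) = 1 - 2 * Real.sin η ^ 2 := by
    rw [Real.cos_two_mul]; linarith
  rw [hC] at h2 s4 ⊢
  generalize Real.sin η = a at *
  generalize Real.cos η = b at *
  generalize Real.sin τ = c at *
  generalize Real.cos τ = d at *
  have hd : d ^ 2 = 1 - c ^ 2 := by linarith
  have key : (2 * a * b * (2 * d ^ 2 - 1) - (1 - 2 * a ^ 2) * (2 * c * d)) *
      (2 * (1 - 2 * a ^ 2) - 1) + (2 * a * b * (2 * d ^ 2 - 1) + (1 - 2 * a ^ 2) * (2 * c * d))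
      - 2 * (2 * a * b) * (1 - 2 * a ^ 2)
      = 2 * (1 - 2 * a ^ 2) * (4 * (a * (c * (a * d - b * c)))) := by
    rw [hd]; ring
  linarith

/-- The trigonometric content of the corner estimate: `A` and `B` are the angles that a vector encloses
with two rays at an angle of at least `θ`, cut off at a right angle. There is equality at `A = B = θ / 2`, and the
right-hand side is concave on the line `A + B = θ`. -/
lemma sin_corner {θ A B : ℝ} (hθ0 : 0 < θ) (hθ' : θ ≤ Real.pi) (hA0 : 0 ≤ A)
    (hB : B ≤ Real.pi / 2) (hAB : A ≤ B)
    (h : θ ≤ A + B ∨ B = Real.pi / 2) :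
    1 ≤ Real.sin A * (1 / Real.sin (θ / 2) - 1 / Real.sin (min θ (Real.pi / 2)))
      + Real.sin B / Real.sin (min θ (Real.pi / 2)) := by
  have hpi := Real.pi_pos
  have hA : A ≤ Real.pi / 2 := hAB.trans hB
  have hs : 0 < Real.sin (θ / 2) := Real.sin_pos_of_pos_of_lt_pi (by linarith) (by linarith)
  have hsA : 0 ≤ Real.sin A := Real.sin_nonneg_of_nonneg_of_le_pi hA0 (by linarith)
  rcases le_total (Real.pi / 2) θ with hc | hc
  · rw [min_eq_right hc, Real.sin_pi_div_two, div_one, div_one]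
    have h1 : 0 ≤ 1 / Real.sin (θ / 2) - 1 := by
      rw [sub_nonneg, le_div_iff₀ hs, one_mul]; exact Real.sin_le_one _
    rcases h with h | rfl
    · have := sin_obtuse_corner hc hθ' hA hB hAB h
      have e : Real.sin A * (1 / Real.sin (θ / 2) - 1) + Real.sin B =
        (Real.sin A * (1 - Real.sin (θ / 2)) + Real.sin (θ / 2) * Real.sin B)
          / Real.sin (θ / 2) := by field_simp
      rw [e, le_div_iff₀ hs, one_mul]; exact this
    · rw [Real.sin_pi_div_two]
      have := mul_nonneg hsA h1
      linarith
  · rw [min_eq_left hc]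
    have hσ : 0 < Real.sin θ := Real.sin_pos_of_pos_of_lt_pi hθ0 (by linarith)
    have hσe : Real.sin θ = 2 * Real.sin (θ / 2) * Real.cos (θ / 2) := by
      rw [← Real.sin_two_mul]; congr 1; ring
    have e : Real.sin A * (1 / Real.sin (θ / 2) - 1 / Real.sin θ) + Real.sin B / Real.sin θ =
        (Real.sin A * (2 * Real.cos (θ / 2) - 1) + Real.sin B) / Real.sin θ := by
      have h1 : 1 / Real.sin (θ / 2) = 2 * Real.cos (θ / 2) / Real.sin θ := by
        rw [div_eq_div_iff hs.ne' hσ.ne', hσe]; ring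
      rw [h1]; ring
    rw [e, le_div_iff₀ hσ, one_mul]
    by_cases hBθ : B ≤ θ
    · rcases h with h | rfl
      · exact sin_acute_corner hθ0 hc hA hBθ hAB h
      · exact sin_acute_corner hθ0 hc hA hBθ hAB (by linarith)
    · have h1 : Real.sin θ ≤ Real.sin B :=
        Real.sin_le_sin_of_le_of_le_pi_div_two (by linarith) hB (by linarith)
      have hk : 0 ≤ 2 * Real.cos (θ / 2) - 1 := by
        have : Real.cos (Real.pi / 3) ≤ Real.cos (θ / 2) :=
          Real.cos_le_cos_of_nonneg_of_le_pi (by linarith) (by linarith) (by linarith)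
        rw [Real.cos_pi_div_three] at this
        linarith
      have := mul_nonneg hsA hk
      linarith

variable {E : Type*} [NormedAddCommGroup E] [InnerProductSpace ℝ E]

/-- The distance from `x` to the ray spanned by `u` is `‖x‖ sin ∠(x, u)`, or `‖x‖` if the angle
is obtuse. -/
lemma norm_mul_sin_le_norm_sub_smul (x u : E) {a : ℝ} (ha : 0 ≤ a) :
    ‖x‖ * Real.sin (min (angle x u) (Real.pi / 2)) ≤ ‖x - a • u‖ := by
  have h0 := angle_nonneg x u
  have hin : inner ℝ x u = ‖x‖ * ‖u‖ * Real.cos (angle x u) := by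
    rw [← cos_angle_mul_norm_mul_norm]; ring
  have hsq : ‖x - a • u‖ ^ 2 = ‖x‖ ^ 2 - 2 * (a * ‖u‖) * (‖x‖ * Real.cos (angle x u))
      + (a * ‖u‖) ^ 2 := by
    rw [norm_sub_sq_real, inner_smul_right, norm_smul, Real.norm_of_nonneg ha, hin]; ring
  apply le_of_sq_le_sq _ (norm_nonneg _)
  rw [hsq, mul_pow]
  rcases le_total (angle x u) (Real.pi / 2) with h | h
  · rw [min_eq_left h, Real.sin_sq]
    nlinarith [sq_nonneg (‖x‖ * Real.cos (angle x u) - a * ‖u‖)]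
  · rw [min_eq_right h, Real.sin_pi_div_two]
    have hc : Real.cos (angle x u) ≤ 0 :=
      Real.cos_nonpos_of_pi_div_two_le_of_le h (by linarith [angle_le_pi x u])
    have : 0 ≤ a * ‖u‖ * (‖x‖ * -Real.cos (angle x u)) := by
      have := neg_nonneg.2 hc; positivity
    nlinarith [sq_nonneg (a * ‖u‖)]

/-- A point that is `ε`-close to one of two rays enclosing an angle of at least `θ`, and
`(ε + L)`-close to the other one, is close to their apex. The bound is attained in the plane, at
the intersection of the boundary lines of the two neighbourhoods. -/
lemma norm_le_of_near_rays {x u v : E} {ε L θ a b : ℝ} (hθ0 : 0 < θ) (hθ : θ ≤ angle u v)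
    (hL : 0 ≤ L) (ha : 0 ≤ a) (hb : 0 ≤ b)
    (hu : ‖x - a • u‖ ≤ ε) (hv : ‖x - b • v‖ ≤ ε + L) :
    ‖x‖ ≤ ε / Real.sin (θ / 2) + L / Real.sin (min θ (Real.pi / 2)) := by
  have hpi := Real.pi_pos
  have hθ' : θ ≤ Real.pi := hθ.trans (angle_le_pi u v)
  have hε : 0 ≤ ε := (norm_nonneg _).trans hu
  have hs : 0 < Real.sin (θ / 2) := Real.sin_pos_of_pos_of_lt_pi (by linarith) (by linarith)
  have hσ : 0 < Real.sin (min θ (Real.pi / 2)) := Real.sin_pos_of_pos_of_lt_pi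
    (lt_min hθ0 (by linarith)) (by linarith [min_le_right θ (Real.pi / 2)])
  have hu' := (norm_mul_sin_le_norm_sub_smul x u ha).trans hu
  have hv' := (norm_mul_sin_le_norm_sub_smul x v hb).trans hv
  have hsum : θ ≤ angle x u + angle x v := by
    rw [angle_comm x u]; exact hθ.trans (angle_le_angle_add_angle u x v)
  have hA0 := angle_nonneg x u
  have hB0 := angle_nonneg x v
  set A := min (angle x u) (Real.pi / 2) with hAd
  set B := min (angle x v) (Real.pi / 2) with hBd
  have hA : A ≤ Real.pi / 2 := min_le_right _ _
  have hB : B ≤ Real.pi / 2 := min_le_right _ _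
  have hA0' : 0 ≤ A := le_min hA0 (by linarith)
  have hN := norm_nonneg x
  rcases le_total A B with hAB | hAB
  · have hc := sin_corner (A := A) (B := B) hθ0 hθ' hA0' hB hAB (by
      rcases le_total (angle x v) (Real.pi / 2) with h | h
      · left
        rcases le_total (angle x u) (Real.pi / 2) with h' | h'
        · rw [hAd, hBd, min_eq_left h, min_eq_left h']; exact hsum
        · have : A = Real.pi / 2 := by rw [hAd, min_eq_right h']
          linarith
      · right; rw [hBd, min_eq_right h])
    have hcoef : 0 ≤ 1 / Real.sin (θ / 2) - 1 / Real.sin (min θ (Real.pi / 2)) := by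
      rw [sub_nonneg]
      apply one_div_le_one_div_of_le hs
      exact Real.sin_le_sin_of_le_of_le_pi_div_two (by linarith) (min_le_right _ _)
        (le_min (by linarith) (by linarith))
    calc ‖x‖ = ‖x‖ * 1 := (mul_one _).symm
      _ ≤ ‖x‖ * (Real.sin A * (1 / Real.sin (θ / 2) - 1 / Real.sin (min θ (Real.pi / 2)))
          + Real.sin B / Real.sin (min θ (Real.pi / 2))) := mul_le_mul_of_nonneg_left hc hN
      _ = (‖x‖ * Real.sin A) * (1 / Real.sin (θ / 2) - 1 / Real.sin (min θ (Real.pi / 2)))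
          + (‖x‖ * Real.sin B) / Real.sin (min θ (Real.pi / 2)) := by ring
      _ ≤ ε * (1 / Real.sin (θ / 2) - 1 / Real.sin (min θ (Real.pi / 2)))
          + (ε + L) / Real.sin (min θ (Real.pi / 2)) :=
        add_le_add (mul_le_mul_of_nonneg_right hu' hcoef) ((div_le_div_iff_of_pos_right hσ).2 hv')
      _ = _ := by ring
  · have hAθ : θ / 2 ≤ A := by
      rcases le_total (angle x u) (Real.pi / 2) with h' | h'
      · have hA' : A = angle x u := by rw [hAd, min_eq_left h']
        rcases le_total (angle x v) (Real.pi / 2) with h | h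
        · have : B = angle x v := by rw [hBd, min_eq_left h]
          linarith
        · have : B = Real.pi / 2 := by rw [hBd, min_eq_right h]
          linarith
      · have : A = Real.pi / 2 := by rw [hAd, min_eq_right h']
        linarith
    have h1 : Real.sin (θ / 2) ≤ Real.sin A :=
      Real.sin_le_sin_of_le_of_le_pi_div_two (by linarith) hA hAθ
    have h2 : ‖x‖ ≤ ε / Real.sin (θ / 2) := by
      rw [le_div_iff₀ hs]
      exact (mul_le_mul_of_nonneg_left h1 hN).trans hu'
    have h3 : 0 ≤ L / Real.sin (min θ (Real.pi / 2)) := by positivity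
    linarith

end Corner

/-! ### The path metric -/

section PathMetric

variable {m : ℕ} {C : Finset (Pt m)} {G : SimpleGraph C}

lemma walkLength_nonneg {a b : C} (p : G.Walk a b) : 0 ≤ walkLength p :=
  List.sum_nonneg fun r hr => by
    obtain ⟨e, -, rfl⟩ := List.mem_map.1 hr
    exact dist_nonneg

lemma walkLength_cons {a b c : C} (h : G.Adj a b) (p : G.Walk b c) :
    walkLength (SimpleGraph.Walk.cons h p) = dist (a : Pt m) (b : Pt m) + walkLength p := by
  simp [walkLength]

lemma walkLength_append {a b c : C} (p : G.Walk a b) (q : G.Walk b c) :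
    walkLength (p.append q) = walkLength p + walkLength q := by
  simp [walkLength, SimpleGraph.Walk.darts_append]

lemma walkLength_reverse {a b : C} (p : G.Walk a b) : walkLength p.reverse = walkLength p := by
  simp [walkLength, SimpleGraph.Walk.darts_reverse, Function.comp_def, dist_comm]

lemma pathDist_le_walkLength {a b : C} (p : G.Walk a b) : pathDist G a b ≤ walkLength p :=
  ciInf_le ⟨0, by rintro _ ⟨q, rfl⟩; exact walkLength_nonneg q⟩ p

lemma pathDist_nonneg (a b : C) : 0 ≤ pathDist G a b :=
  Real.iInf_nonneg fun p => walkLength_nonneg p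

lemma pathDist_comm (a b : C) : pathDist G a b = pathDist G b a := by
  refine Function.Surjective.iInf_congr (fun p : G.Walk a b => p.reverse) ?_ ?_
  · exact fun q => ⟨q.reverse, q.reverse_reverse⟩
  · exact fun p => walkLength_reverse p

lemma pathDist_triangle (hG : G.Connected) (a b c : C) :
    pathDist G a c ≤ pathDist G a b + pathDist G b c := by
  have : Nonempty (G.Walk a b) := hG a b
  have : Nonempty (G.Walk b c) := hG b c
  refine le_ciInf_add_ciInf fun p q => ?_
  rw [← walkLength_append]
  exact pathDist_le_walkLength _

/-- A walk leaving a set uses a boundary edge `c c'`, and is at least as long as the detour through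
that edge. -/
lemma exists_boundary_adj_walkLength (hG : G.Connected) (P : C → Prop) {a b : C} (p : G.Walk a b)
    (ha : P a) (hb : ¬ P b) : ∃ c c' : C, G.Adj c c' ∧ P c ∧ ¬ P c' ∧
      pathDist G a c + dist (c : Pt m) (c' : Pt m) + pathDist G c' b ≤ walkLength p := by
  induction p with
  | nil => exact absurd ha hb
  | @cons a x b h p ih =>
    rw [walkLength_cons]
    by_cases hx : P x
    · obtain ⟨c, c', hc, h1, h2, h3⟩ := ih hx hb
      refine ⟨c, c', hc, h1, h2, ?_⟩
      have h4 := pathDist_triangle hG a x c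
      have h5 : pathDist G a x ≤ dist (a : Pt m) (x : Pt m) := by
        simpa [walkLength] using pathDist_le_walkLength h.toWalk
      linarith
    · refine ⟨a, x, h, ha, hx, ?_⟩
      have h1 : pathDist G a a ≤ 0 := by
        simpa [walkLength] using pathDist_le_walkLength (SimpleGraph.Walk.nil : G.Walk a a)
      have h2 := pathDist_le_walkLength p
      linarith

/-- If every edge leaving a set that contains `a` but not `b` leads to a detour of length at least
`r` even when the edge itself is not counted, then `r < d_G(a, b)`. -/
lemma lt_pathDist_of_boundary (hG : G.Connected) (P : C → Prop) {a b : C} (ha : P a) (hb : ¬ P b)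
    {r : ℝ} (h : ∀ c c' : C, G.Adj c c' → P c → ¬ P c' → r ≤ pathDist G a c + pathDist G c' b) :
    r < pathDist G a b := by
  -- a positive lower bound for the lengths of all edges
  obtain ⟨η, hη, hη'⟩ : ∃ η : ℝ, 0 < η ∧ ∀ c c' : C, G.Adj c c' →
      η ≤ dist (c : Pt m) (c' : Pt m) := by
    have hab : a ≠ b := fun hab => hb (hab ▸ ha)
    let S : Set ℝ := Set.range fun x : {x : C × C // x.1 ≠ x.2} =>
      dist (x.1.1 : Pt m) (x.1.2 : Pt m)
    have hfin : S.Finite := Set.finite_range _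
    have hmem : sInf S ∈ S := Set.Nonempty.csInf_mem ⟨_, ⟨(a, b), hab⟩, rfl⟩ hfin
    refine ⟨sInf S, ?_, fun c c' hc => csInf_le hfin.bddBelow ⟨⟨(c, c'), hc.ne⟩, rfl⟩⟩
    obtain ⟨x, hx⟩ := hmem
    rw [← hx]
    exact dist_pos.2 fun h => x.2 (Subtype.ext h)
  have : Nonempty (G.Walk a b) := hG a b
  have : r + η ≤ pathDist G a b := by
    refine le_ciInf fun p => ?_
    obtain ⟨c, c', hc, h1, h2, h3⟩ := exists_boundary_adj_walkLength hG P p ha hb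
    linarith [hη' c c' hc, h c c' hc h1 h2]
  linarith

end PathMetric

/-! ### Minimum spanning trees -/

section MST


/-- Removing the edge `a b` leaves every vertex connected to one of its ends. -/
lemma reachable_deleteEdges_or {X : Type*} {W : SimpleGraph X} (hW : W.Connected) (a b v : X) :
    (W.deleteEdges {s(a, b)}).Reachable v a ∨ (W.deleteEdges {s(a, b)}).Reachable v b := by
  obtain ⟨p⟩ := hW v a
  induction p with
  | nil => exact Or.inl (SimpleGraph.Reachable.refl _)
  | @cons v x c h p ih =>
    by_cases hvx : s(v, x) = s(c, b)
    · rcases Sym2.eq_iff.1 hvx with ⟨rfl, rfl⟩ | ⟨rfl, rfl⟩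
      · exact Or.inl (SimpleGraph.Reachable.refl _)
      · exact Or.inr (SimpleGraph.Reachable.refl _)
    · have h' : (W.deleteEdges {s(c, b)}).Reachable v x :=
        (SimpleGraph.deleteEdges_adj.2 ⟨h, hvx⟩ : (W.deleteEdges {s(c, b)}).Adj v x).reachable
      exact ih.imp h'.trans h'.trans

variable {X : Type*} [Fintype X] {d : X → X → ℝ}

lemma exists_isMST [Nonempty X] (d : X → X → ℝ) : ∃ W : SimpleGraph X, IsMST d W := by
  classical
  obtain ⟨T, -, hT⟩ := (SimpleGraph.connected_top (V := X)).exists_isTree_le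
  obtain ⟨W, hW, hmin⟩ := Set.exists_min_image {W : SimpleGraph X | W.IsTree} (weight d)
    (Set.toFinite _) ⟨T, hT⟩
  exact ⟨W, hW, hmin⟩

lemma weight_eq (W : SimpleGraph X) [DecidableRel W.Adj] :
    weight d W = (1 / 2) * ∑ a : X, ∑ b : X, if W.Adj a b then d a b else 0 := by
  unfold weight
  congr!

open Classical in
lemma weight_mono (hd : ∀ a b, 0 ≤ d a b) {W W' : SimpleGraph X} (h : W ≤ W') :
    weight d W ≤ weight d W' := by
  rw [weight_eq, weight_eq]
  refine mul_le_mul_of_nonneg_left ?_ (by norm_num)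
  refine Finset.sum_le_sum fun a _ => Finset.sum_le_sum fun b _ => ?_
  by_cases hab : W.Adj a b
  · rw [if_pos hab, if_pos (h hab)]
  · rw [if_neg hab]; split_ifs
    · exact hd a b
    · exact le_rfl

open Classical in
lemma weight_sup_edge_le (hd : ∀ a b, 0 ≤ d a b) (hsymm : ∀ a b, d a b = d b a)
    (W : SimpleGraph X) (x y : X) :
    weight d (W ⊔ SimpleGraph.edge x y) ≤ weight d W + d x y := by
  have h1 : ∀ a b : X, (if (W ⊔ SimpleGraph.edge x y).Adj a b then d a b else 0) ≤
      (if W.Adj a b then d a b else 0) + ((if a = x then (if b = y then d x y else 0) else 0)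
        + (if a = y then (if b = x then d x y else 0) else 0)) := by
    intro a b
    have p1 : 0 ≤ (if W.Adj a b then d a b else 0) := by
      split_ifs; exacts [hd _ _, le_rfl]
    have p2 : 0 ≤ (if a = x then (if b = y then d x y else 0) else 0) := by
      split_ifs; exacts [hd _ _, le_rfl, le_rfl]
    have p3 : 0 ≤ (if a = y then (if b = x then d x y else 0) else 0) := by
      split_ifs; exacts [hd _ _, le_rfl, le_rfl]
    by_cases hW : W.Adj a b
    · rw [if_pos (show (W ⊔ SimpleGraph.edge x y).Adj a b from Or.inl hW), if_pos hW]
      linarith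
    · by_cases h : (W ⊔ SimpleGraph.edge x y).Adj a b
      · rw [if_pos h]
        rcases h with h | h
        · exact absurd h hW
        · rw [SimpleGraph.edge_adj] at h
          rcases h.1 with ⟨rfl, rfl⟩ | ⟨rfl, rfl⟩
          · rw [if_pos rfl, if_pos rfl] at p2 ⊢; linarith
          · rw [if_pos rfl, if_pos rfl] at p3 ⊢; have := hsymm a b; linarith
      · rw [if_neg h]; linarith
  have h2 : ∑ a : X, ∑ b : X, (if (W ⊔ SimpleGraph.edge x y).Adj a b then d a b else 0) ≤
      (∑ a : X, ∑ b : X, if W.Adj a b then d a b else 0) + 2 * d x y := by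
    refine (Finset.sum_le_sum fun a _ => Finset.sum_le_sum fun b _ => h1 a b).trans (le_of_eq ?_)
    simp only [Finset.sum_add_distrib, Finset.sum_ite_irrel, Finset.sum_ite_eq',
      Finset.mem_univ, if_true, Finset.sum_const_zero]
    ring
  rw [weight_eq, weight_eq]
  linarith

open Classical in
lemma weight_deleteEdges_add_le (hd : ∀ a b, 0 ≤ d a b) (hsymm : ∀ a b, d a b = d b a)
    {W : SimpleGraph X} {x y : X} (hxy : W.Adj x y) :
    weight d (W.deleteEdges {s(x, y)}) + d x y ≤ weight d W := by
  have h1 : ∀ a b : X, (if (W.deleteEdges {s(x, y)}).Adj a b then d a b else 0)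
      + ((if a = x then (if b = y then d x y else 0) else 0)
        + (if a = y then (if b = x then d x y else 0) else 0)) ≤
      (if W.Adj a b then d a b else 0) := by
    intro a b
    by_cases hab : s(a, b) = s(x, y)
    · have hW : W.Adj a b := by
        rw [← SimpleGraph.mem_edgeSet, hab]; exact hxy
      rw [if_neg (by simp [SimpleGraph.deleteEdges_adj, hab]), if_pos hW]
      rcases Sym2.eq_iff.1 hab with ⟨rfl, rfl⟩ | ⟨rfl, rfl⟩
      · rw [if_pos rfl, if_pos rfl, if_neg hW.ne]; linarith
      · rw [if_neg hW.ne, if_pos rfl, if_pos rfl, hsymm a b]; linarith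
    · have n1 : ¬ (a = x ∧ b = y) := fun h => hab (by rw [h.1, h.2])
      have n2 : ¬ (a = y ∧ b = x) := fun h => hab (by rw [h.1, h.2, Sym2.eq_swap])
      rw [← ite_and, ← ite_and, if_neg n1, if_neg n2]
      rw [add_zero, add_zero]
      by_cases h : (W.deleteEdges {s(x, y)}).Adj a b
      · rw [if_pos h, if_pos (W.deleteEdges_le _ h)]
      · rw [if_neg h]; split_ifs; exacts [hd _ _, le_rfl]
  have h2 : (∑ a : X, ∑ b : X, if (W.deleteEdges {s(x, y)}).Adj a b then d a b else 0)
      + 2 * d x y ≤ ∑ a : X, ∑ b : X, (if W.Adj a b then d a b else 0) := by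
    refine (le_of_eq ?_).trans
      (Finset.sum_le_sum fun a _ => Finset.sum_le_sum fun b _ => h1 a b)
    simp only [Finset.sum_add_distrib, Finset.sum_ite_irrel, Finset.sum_ite_eq',
      Finset.mem_univ, if_true, Finset.sum_const_zero]
    ring
  rw [weight_eq, weight_eq]
  linarith

/-- The exchange property: a third point `p` cannot be closer to both ends of an edge of a minimum
spanning tree than these ends are to each other. Otherwise the edge `a b` could be replaced by
`p a` or `p b`. -/
lemma IsMST.not_lt_and_lt {W : SimpleGraph X} (hW : IsMST d W) (hd : ∀ a b, 0 ≤ d a b)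
    (hsymm : ∀ a b, d a b = d b a) {a b p : X} (hab : W.Adj a b)
    (ha : d a p < d a b) (hb : d p b < d a b) : False := by
  have hc := hW.1.connected
  have : Nonempty X := ⟨a⟩
  -- it is enough to reconnect the two components of `W - ab` by an edge `p x` shorter than `ab`
  have key : ∀ x, d p x < d a b → (∀ v, (W.deleteEdges {s(a, b)}).Reachable v p ∨
      (W.deleteEdges {s(a, b)}).Reachable v x) → False := by
    intro x hx hv
    set W' := W.deleteEdges {s(a, b)} ⊔ SimpleGraph.edge p x with hW'
    have hle : W.deleteEdges {s(a, b)} ≤ W' := le_sup_left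
    have hpx : W'.Reachable p x := by
      by_cases hne : p = x
      · rw [hne]
      · exact (show W'.Adj p x from Or.inr (by simp [SimpleGraph.edge_adj, hne])).reachable
    have hr : ∀ v, W'.Reachable v p := fun v => (hv v).elim (fun h => h.mono hle)
      fun h => (h.mono hle).trans hpx.symm
    have hconn : W'.Connected := ⟨fun v w => (hr v).trans (hr w).symm⟩
    obtain ⟨T, hT, hT'⟩ := hconn.exists_isTree_le
    have h1 := hW.2 T hT'
    have h2 := weight_mono hd hT
    have h3 := weight_sup_edge_le hd hsymm (W.deleteEdges {s(a, b)}) p x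
    have h4 := weight_deleteEdges_add_le hd hsymm hab
    rw [← hW'] at h3
    linarith
  rcases reachable_deleteEdges_or hc a b p with h | h
  · refine key b hb fun v => (reachable_deleteEdges_or hc a b v).imp (fun h' => h'.trans h.symm) id
  · refine key a (by rwa [hsymm]) fun v =>
      (reachable_deleteEdges_or hc a b v).symm.imp (fun h' => h'.trans h.symm) id

end MST

/-! ### Straight-line realizations of an abstract graph -/

section Realization

variable {X : Type*} {E F : Type*} [NormedAddCommGroup E] [NormedSpace ℝ E]
  [NormedAddCommGroup F] [NormedSpace ℝ F]

/-- The union of the segments `[f a, f b]` over all edges `a b` of the graph `W`, whose vertices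
are placed by `f`. Isolated vertices do not contribute. -/
def edgeUnion (W : SimpleGraph X) (f : X → E) : Set E :=
  {x | ∃ a b : X, W.Adj a b ∧ x ∈ segment ℝ (f a) (f b)}

/-- The placement `f` draws `W` without crossings: edges are non-degenerate, and two distinct
edges meet at most in the image of a common endpoint. -/
structure IsEmbeddedBy (W : SimpleGraph X) (f : X → E) : Prop where
  ne : ∀ a b : X, W.Adj a b → f a ≠ f b
  inter : ∀ a b c d : X, W.Adj a b → W.Adj c d → s(a, b) ≠ s(c, d) →
    ∀ x ∈ segment ℝ (f a) (f b), x ∈ segment ℝ (f c) (f d) →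
      ∃ v, (v = a ∨ v = b) ∧ (v = c ∨ v = d) ∧ x = f v

lemma isCompact_edgeUnion [Finite X] (W : SimpleGraph X) (f : X → E) :
    IsCompact (edgeUnion W f) := by
  have h : edgeUnion W f = ⋃ e : {e : X × X // W.Adj e.1 e.2}, segment ℝ (f e.1.1) (f e.1.2) := by
    ext x
    simp [edgeUnion]
  rw [h]
  refine isCompact_iUnion fun e => ?_
  rw [segment_eq_image_lineMap]
  exact isCompact_Icc.image AffineMap.lineMap_continuous

lemma injOn_segment_of_map_ne (φ : F →L[ℝ] E) {p q : F} (h : φ p ≠ φ q) :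
    Set.InjOn φ (segment ℝ p q) := by
  intro x hx y hy hxy
  rw [segment_eq_image'] at hx hy
  obtain ⟨t, -, rfl⟩ := hx
  obtain ⟨t', -, rfl⟩ := hy
  have h0 : (t - t') • (φ q - φ p) = 0 := by
    simp only [map_add, map_smul, map_sub] at hxy
    rw [sub_smul, sub_eq_zero]
    exact add_left_cancel hxy
  rcases smul_eq_zero.1 h0 with h1 | h1
  · rw [sub_eq_zero.1 h1]
  · exact absurd (sub_eq_zero.1 h1).symm h

/-- A linear map under which the edges of a realization stay disjoint restricts to a homeomorphism:
it is a continuous bijection between compact sets. -/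
lemma nonempty_homeomorph_map_edgeUnion [Finite X] (W : SimpleGraph X) (h : X → F) (φ : F →L[ℝ] E)
    (hφ : IsEmbeddedBy W (fun a => φ (h a))) :
    Nonempty (edgeUnion W h ≃ₜ edgeUnion W (fun a => φ (h a))) := by
  have himg : ∀ a b : X, φ '' segment ℝ (h a) (h b) = segment ℝ (φ (h a)) (φ (h b)) :=
    fun a b => image_segment ℝ φ.toLinearMap.toAffineMap (h a) (h b)
  have hinj : Set.InjOn φ (edgeUnion W h) := by
    rintro x ⟨a, b, hab, hx⟩ y ⟨c, d, hcd, hy⟩ hxy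
    have hx' := himg a b ▸ Set.mem_image_of_mem φ hx
    have hy' := himg c d ▸ Set.mem_image_of_mem φ hy
    have hiab := injOn_segment_of_map_ne φ (hφ.ne a b hab)
    have hicd := injOn_segment_of_map_ne φ (hφ.ne c d hcd)
    by_cases he : s(a, b) = s(c, d)
    · rcases Sym2.eq_iff.1 he with ⟨rfl, rfl⟩ | ⟨rfl, rfl⟩
      · exact hiab hx hy hxy
      · exact hiab hx (segment_symm ℝ (h b) (h a) ▸ hy) hxy
    · obtain ⟨v, hv, hv', hxv⟩ := hφ.inter a b c d hab hcd he (φ x) hx' (hxy ▸ hy')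
      have h1 : x = h v := hiab hx (by
        rcases hv with rfl | rfl
        exacts [left_mem_segment ℝ _ _, right_mem_segment ℝ _ _]) hxv
      have h2 : y = h v := hicd hy (by
        rcases hv' with rfl | rfl
        exacts [left_mem_segment ℝ _ _, right_mem_segment ℝ _ _]) (hxy ▸ hxv)
      rw [h1, h2]
  have hsurj : φ '' edgeUnion W h = edgeUnion W (fun a => φ (h a)) := by
    ext y
    constructor
    · rintro ⟨x, ⟨a, b, hab, hx⟩, rfl⟩
      exact ⟨a, b, hab, himg a b ▸ Set.mem_image_of_mem φ hx⟩
    · rintro ⟨a, b, hab, hy⟩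
      rw [← himg a b] at hy
      obtain ⟨x, hx, rfl⟩ := hy
      exact ⟨x, ⟨a, b, hab, hx⟩, rfl⟩
  have : CompactSpace (edgeUnion W h) := isCompact_iff_compactSpace.1 (isCompact_edgeUnion W h)
  have hbij : Set.BijOn φ (edgeUnion W h) (edgeUnion W fun a => φ (h a)) :=
    hsurj ▸ hinj.bijOn_image
  refine ⟨Continuous.homeoOfEquivCompactToT2 (f := hbij.equiv φ) ?_⟩
  exact (φ.continuous.comp continuous_subtype_val).subtype_mk _

/-- Two crossing-free straight-line realizations of the same finite graph are homeomorphic: both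
are linear projections of the realization in the product space that uses both placements. -/
lemma nonempty_homeomorph_edgeUnion [Finite X] {W : SimpleGraph X} {f : X → E} {g : X → F}
    (hf : IsEmbeddedBy W f) (hg : IsEmbeddedBy W g) :
    Nonempty (edgeUnion W f ≃ₜ edgeUnion W g) := by
  obtain ⟨e₁⟩ := nonempty_homeomorph_map_edgeUnion W (fun a => (f a, g a))
    (ContinuousLinearMap.fst ℝ E F) hf
  obtain ⟨e₂⟩ := nonempty_homeomorph_map_edgeUnion W (fun a => (f a, g a))
    (ContinuousLinearMap.snd ℝ E F) hg
  exact ⟨e₁.symm.trans e₂⟩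

lemma drawing_eq_edgeUnion {m : ℕ} {S : Finset (Pt m)} {W : SimpleGraph S}
    (hW : ∀ v : S, ∃ w, W.Adj v w) : drawing W = edgeUnion W (fun a : S => (a : Pt m)) := by
  ext x
  constructor
  · rintro (hx | hx)
    · obtain ⟨w, hw⟩ := hW ⟨x, hx⟩
      exact ⟨⟨x, hx⟩, w, hw, left_mem_segment ℝ _ _⟩
    · exact hx
  · exact fun hx => Or.inr hx

end Realization

/-! ### Coordinates along a segment -/

section Coordinates

variable {m : ℕ} {ε : ℝ} {p q x y : Pt m}

/-- The unit vector pointing from `p` to `q` (zero if `p = q`). -/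
def direction (p q : Pt m) : Pt m := ‖q - p‖⁻¹ • (q - p)

/-- The signed length of the orthogonal projection of `x - p` to the line through `p` and `q`. -/
def coord (p q x : Pt m) : ℝ := inner ℝ (direction p q) (x - p)

lemma norm_direction (h : p ≠ q) : ‖direction p q‖ = 1 := by
  have : ‖q - p‖ ≠ 0 := norm_ne_zero_iff.2 (sub_ne_zero.2 h.symm)
  rw [direction, norm_smul, norm_inv, norm_norm, inv_mul_cancel₀ this]

lemma smul_direction (p q : Pt m) : ‖q - p‖ • direction p q = q - p := by
  rcases eq_or_ne p q with rfl | h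
  · simp
  · rw [direction, smul_smul, mul_inv_cancel₀ (norm_ne_zero_iff.2 (sub_ne_zero.2 h.symm)), one_smul]

lemma direction_swap (p q : Pt m) : direction q p = - direction p q := by
  rw [direction, direction, norm_sub_rev, ← smul_neg, neg_sub]

lemma coord_sub_coord (p q x y : Pt m) :
    coord p q x - coord p q y = inner ℝ (direction p q) (x - y) := by
  rw [coord, coord, ← inner_sub_right, sub_sub_sub_cancel_right]

lemma abs_coord_sub_coord_le (h : p ≠ q) (x y : Pt m) :
    |coord p q x - coord p q y| ≤ dist x y := by
  rw [coord_sub_coord, dist_eq_norm]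
  simpa [norm_direction h] using abs_real_inner_le_norm (direction p q) (x - y)

@[simp]
lemma coord_left (p q : Pt m) : coord p q p = 0 := by simp [coord]

lemma coord_right (p q : Pt m) : coord p q q = dist p q := by
  rcases eq_or_ne p q with rfl | h
  · simp [coord]
  · rw [coord]
    conv_lhs => rw [← smul_direction p q]
    rw [inner_smul_right, real_inner_self_eq_norm_sq, norm_direction h, dist_eq_norm,
      norm_sub_rev]
    ring

lemma coord_swap (p q x : Pt m) : coord q p x = dist p q - coord p q x := by
  rw [← coord_right, coord_sub_coord, coord, direction_swap, inner_neg_left, ← inner_neg_right,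
    neg_sub]

/-- Coordinates are affine functions. -/
lemma coord_mem_segment {a b : Pt m} (p q : Pt m) (hx : x ∈ segment ℝ a b) :
    coord p q x ∈ segment ℝ (coord p q a) (coord p q b) := by
  obtain ⟨s, t, hs, ht, hst, rfl⟩ := hx
  refine ⟨s, t, hs, ht, hst, ?_⟩
  have : s • a + t • b - p = s • (a - p) + t • (b - p) := by
    obtain rfl : t = 1 - s := by linarith
    module
  rw [coord, coord, coord, this, inner_add_right, inner_smul_right, inner_smul_right, smul_eq_mul,
    smul_eq_mul]

lemma eq_of_coord_eq {a b : Pt m} (hx : x ∈ segment ℝ a b) (hab : coord p q a ≠ coord p q b)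
    (h : coord p q x = coord p q a) : x = a := by
  have e : ∀ z, coord p q z = innerSL ℝ (direction p q) z - inner ℝ (direction p q) p := by
    intro z
    rw [coord, inner_sub_right, innerSL_apply_apply]
  rw [e, e] at h hab
  exact injOn_segment_of_map_ne (innerSL ℝ (direction p q)) (fun h => hab (by rw [h])) hx
    (left_mem_segment ℝ _ _) (by linarith)

lemma offset_segment_symm (p q : Pt m) (ε : ℝ) :
    offset (segment ℝ q p) ε = offset (segment ℝ p q) ε := by
  rw [segment_symm]

lemma mem_offset_left (h : dist x p ≤ ε) : x ∈ offset (segment ℝ p q) ε :=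
  ⟨p, left_mem_segment ℝ _ _, h⟩

lemma mem_offset_right (h : dist x q ≤ ε) : x ∈ offset (segment ℝ p q) ε :=
  ⟨q, right_mem_segment ℝ _ _, h⟩

lemma convex_offset_segment (p q : Pt m) (ε : ℝ) : Convex ℝ (offset (segment ℝ p q) ε) := by
  rintro x ⟨x', hx', hx⟩ y ⟨y', hy', hy⟩ s t hs ht hst
  refine ⟨s • x' + t • y', convex_segment p q hx' hy' hs ht hst, ?_⟩
  rw [dist_eq_norm] at *
  calc ‖s • x + t • y - (s • x' + t • y')‖ = ‖s • (x - x') + t • (y - y')‖ := by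
        congr 1; module
    _ ≤ s * ‖x - x'‖ + t * ‖y - y'‖ := by
        refine (norm_add_le _ _).trans (le_of_eq ?_)
        rw [norm_smul, norm_smul, Real.norm_of_nonneg hs, Real.norm_of_nonneg ht]
    _ ≤ s * ε + t * ε := add_le_add (mul_le_mul_of_nonneg_left hx hs)
        (mul_le_mul_of_nonneg_left hy ht)
    _ = ε := by rw [← add_mul, hst, one_mul]

lemma neg_le_coord (h : p ≠ q) (hx : x ∈ offset (segment ℝ p q) ε) : -ε ≤ coord p q x := by
  obtain ⟨x', hx', hd⟩ := hx
  have h1 := abs_le.1 ((abs_coord_sub_coord_le h x x').trans hd)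
  have h2 := coord_mem_segment p q hx'
  rw [coord_left, coord_right, segment_eq_Icc dist_nonneg] at h2
  linarith [h2.1]

lemma coord_le (h : p ≠ q) (hx : x ∈ offset (segment ℝ p q) ε) : coord p q x ≤ dist p q + ε := by
  have := neg_le_coord h.symm (offset_segment_symm p q ε ▸ hx)
  rw [coord_swap] at this
  linarith

/-- Within the `ε`-offset of a segment, the coordinate determines the distance up to `2ε`. -/
lemma dist_le_abs_coord_sub_coord (h : p ≠ q) (hx : x ∈ offset (segment ℝ p q) ε)
    (hy : y ∈ offset (segment ℝ p q) ε) :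
    dist x y ≤ |coord p q x - coord p q y| + 2 * ε := by
  have hu := norm_direction h
  have hperp : ∀ z : Pt m, ‖z - (inner ℝ (direction p q) z : ℝ) • direction p q‖ ≤ ‖z‖ := by
    intro z
    apply le_of_sq_le_sq _ (norm_nonneg _)
    rw [norm_sub_sq_real, inner_smul_right, real_inner_comm, norm_smul, hu, mul_one,
      Real.norm_eq_abs, sq_abs]
    nlinarith [sq_nonneg (inner ℝ (direction p q) z : ℝ)]
  have hn : ∀ z ∈ offset (segment ℝ p q) ε, ‖z - p - coord p q z • direction p q‖ ≤ ε := by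
    rintro z ⟨z', hz', hd⟩
    rw [segment_eq_image'] at hz'
    obtain ⟨t, -, rfl⟩ := hz'
    refine le_trans (le_of_eq ?_) ((hperp _).trans (dist_eq_norm z _ ▸ hd))
    have e : z - (p + t • (q - p)) = (z - p) - (t * ‖q - p‖) • direction p q := by
      rw [mul_smul, smul_direction]; abel
    rw [e, inner_sub_right, inner_smul_right, real_inner_self_eq_norm_sq, hu]
    congr 1
    rw [coord]
    module
  have e : x - y = (coord p q x - coord p q y) • direction p q
      + ((x - p - coord p q x • direction p q) - (y - p - coord p q y • direction p q)) := by
    module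
  rw [dist_eq_norm, e]
  refine (norm_add_le _ _).trans ?_
  rw [norm_smul, hu, mul_one, Real.norm_eq_abs]
  linarith [norm_sub_le (x - p - coord p q x • direction p q)
    (y - p - coord p q y • direction p q), hn x hx, hn y hy]

/-- `norm_le_of_near_rays` for two points of the offsets of two segments with a common endpoint. -/
lemma dist_le_of_near_segments {w a b c c' : Pt m} {θ L : ℝ} (hθ0 : 0 < θ)
    (hθ : θ ≤ EuclideanGeometry.angle a w b)
    (hc : c ∈ offset (segment ℝ w a) ε) (hc' : c' ∈ offset (segment ℝ w b) ε)
    (hL : dist c c' ≤ L) :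
    dist c w ≤ ε / Real.sin (θ / 2) + L / Real.sin (min θ (Real.pi / 2)) := by
  obtain ⟨x, hx, hcx⟩ := hc
  obtain ⟨y, hy, hcy⟩ := hc'
  rw [segment_eq_image'] at hx hy
  obtain ⟨s, hs, rfl⟩ := hx
  obtain ⟨t, ht, rfl⟩ := hy
  rw [dist_eq_norm]
  refine norm_le_of_near_rays (u := a - w) (v := b - w) hθ0 hθ (dist_nonneg.trans hL) hs.1 ht.1
    ?_ ?_
  · rwa [sub_sub, ← dist_eq_norm]
  · rw [sub_sub, ← dist_eq_norm]
    linarith [dist_triangle c c' (w + t • (b - w))]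

end Coordinates

/-! ### Metric data of straight-line graphs -/

section MetricData

variable {m : ℕ} {S : Finset (Pt m)}

lemma maxEdgeLength_nonneg (G : SimpleGraph S) : 0 ≤ maxEdgeLength G :=
  Real.sSup_nonneg fun r hr => by
    obtain ⟨a, b, -, rfl⟩ := hr
    exact dist_nonneg

lemma dist_le_maxEdgeLength {G : SimpleGraph S} {a b : S} (h : G.Adj a b) :
    dist (a : Pt m) (b : Pt m) ≤ maxEdgeLength G := by
  refine le_csSup (Set.Finite.bddAbove ?_) ⟨a, b, h, rfl⟩
  refine (Set.finite_range fun x : S × S => dist (x.1 : Pt m) (x.2 : Pt m)).subset ?_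
  rintro r ⟨a, b, -, rfl⟩
  exact ⟨(a, b), rfl⟩

lemma minDist_le_dist {A B : Set (Pt m)} {x y : Pt m} (hx : x ∈ A) (hy : y ∈ B) :
    minDist A B ≤ dist x y := by
  refine csInf_le ⟨0, ?_⟩ ⟨x, hx, y, hy, rfl⟩
  rintro r ⟨x, -, y, -, rfl⟩
  exact dist_nonneg

lemma minAngle_le_angle {T : SimpleGraph S} {v a b : S} (ha : T.Adj v a) (hb : T.Adj v b)
    (hab : a ≠ b) : minAngle T ≤ EuclideanGeometry.angle (a : Pt m) (v : Pt m) (b : Pt m) := by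
  refine csInf_le ⟨0, ?_⟩ (Or.inr ⟨v, a, b, ha, hb, hab, rfl⟩)
  rintro r (rfl | ⟨v, a, b, -, -, -, rfl⟩)
  exacts [Real.pi_pos.le, EuclideanGeometry.angle_nonneg _ _ _]

lemma minAngle_le_pi (T : SimpleGraph S) : minAngle T ≤ Real.pi := by
  refine csInf_le ⟨0, ?_⟩ (Or.inl rfl)
  rintro r (rfl | ⟨v, a, b, -, -, -, rfl⟩)
  exacts [Real.pi_pos.le, EuclideanGeometry.angle_nonneg _ _ _]

lemma minAngle_pos {T : SimpleGraph S} (hT : IsStraightLineTree T) : 0 < minAngle T := by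
  -- two edges enclosing the angle `0` would overlap in the shorter one
  have key : ∀ v a b : S, T.Adj v a → T.Adj v b → a ≠ b →
      (a : Pt m) ∉ segment ℝ (v : Pt m) (b : Pt m) := by
    intro v a b ha hb hab hmem
    have hne : s(v, a) ≠ s(v, b) := by
      intro h
      rcases Sym2.eq_iff.1 h with h | h
      · exact hab h.2
      · exact hb.ne h.1
    obtain ⟨-, h | h⟩ := hT.embedded v a v b ha hb hne a (right_mem_segment ℝ _ _) hmem
    · exact ha.ne (Subtype.ext h.symm)
    · exact hab (Subtype.ext h)
  have hfin : ({Real.pi} ∪ {φ | ∃ v a b : S, T.Adj v a ∧ T.Adj v b ∧ a ≠ b ∧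
      φ = EuclideanGeometry.angle (a : Pt m) (v : Pt m) (b : Pt m)}).Finite := by
    refine (Set.finite_singleton _).union ((Set.finite_range fun x : S × S × S =>
      EuclideanGeometry.angle (x.2.1 : Pt m) (x.1 : Pt m) (x.2.2 : Pt m)).subset ?_)
    rintro r ⟨v, a, b, -, -, -, rfl⟩
    exact ⟨(v, a, b), rfl⟩
  have hmem := Set.Nonempty.csInf_mem ⟨Real.pi, Or.inl rfl⟩ hfin
  change minAngle T ∈ _ at hmem
  rcases hmem with h | ⟨v, a, b, ha, hb, hab, h⟩
  · rw [Set.mem_singleton_iff.1 h]; exact Real.pi_pos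
  · rw [h]
    refine lt_of_le_of_ne (EuclideanGeometry.angle_nonneg _ _ _) fun h0 => ?_
    obtain ⟨-, r, hr, hr'⟩ := InnerProductGeometry.angle_eq_zero_iff.1 h0.symm
    simp only [vsub_eq_sub] at hr'
    rcases le_total r 1 with h1 | h1
    · refine key v b a hb ha hab.symm ?_
      rw [segment_eq_image']
      exact ⟨r, ⟨hr.le, h1⟩, by simp only [← hr', add_sub_cancel]⟩
    · refine key v a b ha hb hab ?_
      rw [segment_eq_image']
      refine ⟨r⁻¹, ⟨by positivity, inv_le_one_of_one_le₀ h1⟩, ?_⟩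
      simp only [hr', smul_smul, inv_mul_cancel₀ hr.ne', one_smul, add_sub_cancel]

end MetricData

/-! ### Sides of an edge of a tree -/

section Sides

variable {V : Type*} {T : SimpleGraph V}

/-- `S` is the set of vertices on the side of `u` of the edge `w u`, that is, the component of `u`
after this edge is removed. -/
structure IsSide (T : SimpleGraph V) (w u : V) (S : Set V) : Prop where
  right_mem : u ∈ S
  left_notMem : w ∉ S
  mem_iff : ∀ x y : V, T.Adj x y → s(x, y) ≠ s(w, u) → (x ∈ S ↔ y ∈ S)

lemma isSide_reachable (hT : T.IsAcyclic) {w u : V} (h : T.Adj w u) :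
    IsSide T w u {x | (T.deleteEdges {s(w, u)}).Reachable u x} where
  right_mem := SimpleGraph.Reachable.refl _
  left_notMem := fun hr => SimpleGraph.isBridge_iff.1
    (SimpleGraph.isAcyclic_iff_forall_adj_isBridge.1 hT h) hr.symm
  mem_iff := fun x y hxy hne => by
    have h1 : (T.deleteEdges {s(w, u)}).Adj x y := SimpleGraph.deleteEdges_adj.2 ⟨hxy, hne⟩
    exact ⟨fun h => h.trans h1.reachable, fun h => h.trans h1.symm.reachable⟩

/-- Every vertex other than `z` lies on the far side of an edge at `z`. -/
lemma exists_isSide_mem (hT : T.IsTree) {z x : V} (h : z ≠ x) :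
    ∃ v S, T.Adj z v ∧ IsSide T z v S ∧ x ∈ S := by
  classical
  obtain ⟨p, hp, -⟩ := hT.existsUnique_path z x
  cases p with
  | nil => exact absurd rfl h
  | @cons _ v _ hzv q =>
    refine ⟨v, _, hzv, isSide_reachable hT.isAcyclic hzv, ?_⟩
    obtain ⟨hq, hz⟩ := (SimpleGraph.Walk.cons_isPath_iff _ _).1 hp
    exact SimpleGraph.reachable_deleteEdges_iff_exists_walk.2
      ⟨q, fun he => hz (q.fst_mem_support_of_mem_edges he)⟩

end Sides

/-! ### Sparse points near a straight-line tree -/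

section Sparse

variable {m : ℕ} {ε γ δ : ℝ} {V C D : Finset (Pt m)} {T : SimpleGraph V} {G : SimpleGraph C}
  {hDC : D ⊆ C}

/-- The bound of `dist_le_of_near_segments` for the distance between a vertex of `T` and the ends
of an edge of `G` that jumps between two edges of `T` at that vertex. -/
def cornerRadius (T : SimpleGraph V) (G : SimpleGraph C) (ε : ℝ) : ℝ :=
  ε / Real.sin (minAngle T / 2) + maxEdgeLength G / Real.sin (min (minAngle T) (Real.pi / 2))

/-- A straight-line tree `T` with an `ε`-sample `C`, a `γ`-approximation `G` and a `δ`-sparse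
subset `D` of `C` that marks the vertices of `T`. -/
structure IsSparseModel (ε γ δ : ℝ) (T : SimpleGraph V) (G : SimpleGraph C) (hDC : D ⊆ C) :
    Prop where
  tree : IsStraightLineTree T
  two_le_card : 2 ≤ V.card
  sample : IsSample T C ε
  one_le : 1 ≤ γ
  approx : IsApproximation T ε γ G
  sparse : IsSparse (pathDistOn G hDC) δ
  cover : (V : Set (Pt m)) ⊆ offset (D : Set (Pt m)) ε
  separated : ∀ u v : V, T.Adj u v → ∀ p ∈ D,
    ¬ (dist p (u : Pt m) ≤ ε ∧ dist p (v : Pt m) ≤ ε)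
  le_delta : 2 * γ * (ε + cornerRadius T G ε) ≤ δ

/-- `x` lies in the `ε`-offset of the segment from `w` to `u`. -/
abbrev Near (ε : ℝ) (w u : V) (x : Pt m) : Prop := x ∈ offset (segment ℝ (w : Pt m) (u : Pt m)) ε

lemma Near.symm {w u : V} {x : Pt m} (h : Near ε w u x) : Near ε u w x := by
  rwa [Near, offset_segment_symm]

lemma ne_of_adj {w u : V} (h : T.Adj w u) : (w : Pt m) ≠ (u : Pt m) :=
  fun e => h.ne (Subtype.ext e)

namespace IsSparseModel

variable (M : IsSparseModel ε γ δ T G hDC)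
include M

lemma exists_adj (v : V) : ∃ u, T.Adj v u := by
  have : Nontrivial V :=
    Fintype.one_lt_card_iff_nontrivial.1 (by rw [Fintype.card_coe]; exact M.two_le_card)
  exact M.tree.isTree.connected.preconnected.exists_adj_of_nontrivial v

/-- The points of `D` within `ε` of a vertex are its marks; by `mark_unique` there is only one. -/
lemma exists_mark (v : V) : ∃ p : D, dist (p : Pt m) (v : Pt m) ≤ ε := by
  obtain ⟨q, hq, h⟩ := M.cover v.2
  exact ⟨⟨q, hq⟩, by rwa [dist_comm]⟩

lemma eps_nonneg : 0 ≤ ε := by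
  obtain ⟨v, hv⟩ : V.Nonempty := Finset.card_pos.1 (by have := M.two_le_card; omega)
  obtain ⟨p, hp⟩ := M.exists_mark ⟨v, hv⟩
  exact dist_nonneg.trans hp

lemma exists_near {c : Pt m} (hc : c ∈ C) : ∃ w u, T.Adj w u ∧ Near ε w u c := by
  obtain ⟨q, hq | ⟨w, u, h, hq⟩, hd⟩ := M.sample hc
  · obtain ⟨u, hu⟩ := M.exists_adj ⟨q, hq⟩
    exact ⟨⟨q, hq⟩, u, hu, mem_offset_left hd⟩
  · exact ⟨w, u, h, q, hq, hd⟩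

lemma not_mark_both {w u : V} (h : T.Adj w u) {p : D} (hw : dist (p : Pt m) (w : Pt m) ≤ ε)
    (hu : dist (p : Pt m) (u : Pt m) ≤ ε) : False :=
  M.separated w u h p p.2 ⟨hw, hu⟩

lemma nontrivial : Nontrivial D := by
  obtain ⟨v, hv⟩ : V.Nonempty := Finset.card_pos.1 (by have := M.two_le_card; omega)
  obtain ⟨u, hu⟩ := M.exists_adj ⟨v, hv⟩
  obtain ⟨p, hp⟩ := M.exists_mark ⟨v, hv⟩
  obtain ⟨q, hq⟩ := M.exists_mark u
  exact ⟨p, q, fun e => M.not_mark_both hu hp (e ▸ hq)⟩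

lemma maxEdgeLength_pos : 0 < maxEdgeLength G := by
  have := M.nontrivial
  obtain ⟨p⟩ : Nonempty D := inferInstance
  obtain ⟨q, hq⟩ := exists_ne p
  have : Nontrivial C := ⟨⟨p, hDC p.2⟩, ⟨q, hDC q.2⟩, fun e => hq (Subtype.ext
    (congrArg (fun c : C => (c : Pt m)) e).symm)⟩
  obtain ⟨c, hc⟩ := M.approx.connected.preconnected.exists_adj_of_nontrivial ⟨p, hDC p.2⟩
  exact (dist_pos.2 (ne_of_adj hc)).trans_le (dist_le_maxEdgeLength hc)

lemma minAngle_pos : 0 < minAngle T := SLGraph.minAngle_pos M.tree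

lemma sin_half_pos : 0 < Real.sin (minAngle T / 2) :=
  Real.sin_pos_of_pos_of_lt_pi (by linarith [M.minAngle_pos])
    (by linarith [M.minAngle_pos, minAngle_le_pi T])

lemma sin_min_pos : 0 < Real.sin (min (minAngle T) (Real.pi / 2)) :=
  Real.sin_pos_of_pos_of_lt_pi (lt_min M.minAngle_pos (by linarith [Real.pi_pos]))
    (by linarith [Real.pi_pos, min_le_right (minAngle T) (Real.pi / 2)])

lemma eps_le_div : ε ≤ ε / Real.sin (minAngle T / 2) := by
  rw [le_div_iff₀ M.sin_half_pos]
  exact mul_le_of_le_one_right M.eps_nonneg (Real.sin_le_one _)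

lemma div_add_le_cornerRadius :
    ε / Real.sin (minAngle T / 2) + maxEdgeLength G ≤ cornerRadius T G ε := by
  refine add_le_add le_rfl ?_
  rw [le_div_iff₀ M.sin_min_pos]
  exact mul_le_of_le_one_right (maxEdgeLength_nonneg G) (Real.sin_le_one _)

lemma eps_add_le_cornerRadius : ε + maxEdgeLength G ≤ cornerRadius T G ε :=
  le_trans (by linarith [M.eps_le_div]) M.div_add_le_cornerRadius

lemma eps_lt_cornerRadius : ε < cornerRadius T G ε := by
  linarith [M.eps_add_le_cornerRadius, M.maxEdgeLength_pos]

/-- An edge of `G` can only jump between edges of `T` that have a common vertex. -/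
lemma common_vertex {w u x y : V} (h : T.Adj w u) (h' : T.Adj x y) {c c' : Pt m}
    (hc : Near ε w u c) (hc' : Near ε x y c') (hd : dist c c' ≤ maxEdgeLength G) :
    w = x ∨ w = y ∨ u = x ∨ u = y := by
  by_contra! hne
  obtain ⟨q, hq, hcq⟩ := hc
  obtain ⟨q', hq', hcq'⟩ := hc'
  have h1 := M.approx.lt_minDist w u x y h h' hne.1 hne.2.1 hne.2.2.1 hne.2.2.2
  have h2 := minDist_le_dist hq hq'
  linarith [dist_comm c q, dist_comm c' q', dist_triangle q c q', dist_triangle c c' q']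

/-- An edge of `G` that jumps between two edges of `T` at `z` is close to `z`. -/
lemma dist_vertex_le {z a b : V} (ha : T.Adj z a) (hb : T.Adj z b) (hab : a ≠ b) {c c' : Pt m}
    (hc : Near ε z a c) (hc' : Near ε z b c') (hd : dist c c' ≤ maxEdgeLength G) :
    dist c (z : Pt m) ≤ cornerRadius T G ε :=
  dist_le_of_near_segments M.minAngle_pos (minAngle_le_angle ha hb hab) hc hc' hd

lemma dist_vertex_le_div {z a b : V} (ha : T.Adj z a) (hb : T.Adj z b) (hab : a ≠ b) {c : Pt m}
    (hc : Near ε z a c) (hc' : Near ε z b c) :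
    dist c (z : Pt m) ≤ ε / Real.sin (minAngle T / 2) := by
  simpa using dist_le_of_near_segments M.minAngle_pos (minAngle_le_angle ha hb hab) hc hc'
    (dist_self c).le

lemma pathDistOn_le {w u : V} (h : T.Adj w u) {a b : D} (ha : Near ε w u a) (hb : Near ε w u b) :
    pathDistOn G hDC a b ≤ γ * dist (a : Pt m) (b : Pt m) :=
  M.approx.pathDist_le w u h _ _ ha hb

/-- Distinct points of `D` near the same edge of `T` are far apart in the Euclidean metric. -/
lemma le_dist {w u : V} (h : T.Adj w u) {a b : D} (ha : Near ε w u a) (hb : Near ε w u b)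
    (hab : a ≠ b) : 2 * (ε + cornerRadius T G ε) ≤ dist (a : Pt m) (b : Pt m) := by
  have h1 := M.sparse a b hab
  have h2 := M.pathDistOn_le h ha hb
  have h3 := M.le_delta
  have hγ : 0 < γ := by linarith [M.one_le]
  refine le_of_mul_le_mul_left (a := γ) ?_ hγ
  linarith

lemma le_abs_coord_sub {w u : V} (h : T.Adj w u) {a b : D} (ha : Near ε w u a)
    (hb : Near ε w u b) (hab : a ≠ b) :
    2 * cornerRadius T G ε ≤ |coord (w : Pt m) u a - coord (w : Pt m) u b| := by
  have h1 := M.le_dist h ha hb hab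
  have h2 := dist_le_abs_coord_sub_coord (ne_of_adj h) ha hb
  linarith

lemma coord_injective {w u : V} (h : T.Adj w u) {a b : D} (ha : Near ε w u a)
    (hb : Near ε w u b) (hab : coord (w : Pt m) u a = coord (w : Pt m) u b) : a = b := by
  by_contra hne
  have := M.le_abs_coord_sub h ha hb hne
  rw [hab, sub_self, abs_zero] at this
  linarith [M.eps_lt_cornerRadius, M.eps_nonneg]

lemma mark_unique {v : V} {p q : D} (hp : dist (p : Pt m) (v : Pt m) ≤ ε)
    (hq : dist (q : Pt m) (v : Pt m) ≤ ε) : p = q := by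
  obtain ⟨u, hu⟩ := M.exists_adj v
  by_contra hne
  have h1 := M.le_dist hu (mem_offset_left hp) (mem_offset_left hq) hne
  have h2 := dist_triangle_right (p : Pt m) q v
  linarith [M.eps_lt_cornerRadius, M.eps_nonneg]

/-- A point of `D` close to two edges marks their common vertex. -/
lemma mark_of_near_of_near {z a b : V} (ha : T.Adj z a) (hb : T.Adj z b) (hab : a ≠ b) {p : D}
    (hpa : Near ε z a p) (hpb : Near ε z b p) : dist (p : Pt m) (z : Pt m) ≤ ε := by
  obtain ⟨q, hq⟩ := M.exists_mark z
  by_cases hne : p = q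
  · rwa [hne]
  · have h1 := M.le_dist ha hpa (mem_offset_left hq) hne
    have h2 := M.dist_vertex_le_div ha hb hab hpa hpb
    have h3 := dist_triangle_right (p : Pt m) q z
    linarith [M.div_add_le_cornerRadius, M.maxEdgeLength_pos, M.eps_nonneg]

/-- The mark of the first vertex of an edge comes first along that edge. -/
lemma coord_mark_left {w u : V} (h : T.Adj w u) {p q : D} (hp : Near ε w u p)
    (hq : dist (q : Pt m) (w : Pt m) ≤ ε) (hne : p ≠ q) :
    coord (w : Pt m) u q + 2 * cornerRadius T G ε ≤ coord (w : Pt m) u p := by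
  have h1 := M.le_abs_coord_sub h hp (mem_offset_left hq) hne
  have h2 := neg_le_coord (ne_of_adj h) hp
  have h3 := abs_le.1 ((abs_coord_sub_coord_le (ne_of_adj h) (q : Pt m) w).trans hq)
  rw [coord_left] at h3
  have := M.eps_lt_cornerRadius
  rcases le_abs.1 h1 with h1 | h1 <;> linarith [h3.2]

lemma coord_mark_right {w u : V} (h : T.Adj w u) {p q : D} (hp : Near ε w u p)
    (hq : dist (q : Pt m) (u : Pt m) ≤ ε) (hne : p ≠ q) :
    coord (w : Pt m) u p + 2 * cornerRadius T G ε ≤ coord (w : Pt m) u q := by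
  have := M.coord_mark_left h.symm hp.symm hq hne
  rw [coord_swap (w : Pt m) u, coord_swap (w : Pt m) u] at this
  linarith

/-- A point of `D` that does not lie beyond a point close to the first vertex marks that vertex. -/
lemma mark_left_of_coord_le {w u : V} (h : T.Adj w u) {p : D} (hp : Near ε w u p) {c : Pt m}
    (hc : dist c (w : Pt m) ≤ cornerRadius T G ε)
    (hpc : coord (w : Pt m) u p ≤ coord (w : Pt m) u c) : dist (p : Pt m) (w : Pt m) ≤ ε := by
  obtain ⟨q, hq⟩ := M.exists_mark w
  by_cases hne : p = q
  · rwa [hne]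
  · have h1 := M.coord_mark_left h hp hq hne
    have h2 := neg_le_coord (ne_of_adj h) (mem_offset_left hq : Near ε w u q)
    have h3 := abs_le.1 ((abs_coord_sub_coord_le (ne_of_adj h) c w).trans hc)
    rw [coord_left] at h3
    linarith [h3.2, M.eps_lt_cornerRadius]

lemma mark_right_of_le_coord {w u : V} (h : T.Adj w u) {p : D} (hp : Near ε w u p) {c : Pt m}
    (hc : dist c (u : Pt m) ≤ cornerRadius T G ε)
    (hpc : coord (w : Pt m) u c ≤ coord (w : Pt m) u p) : dist (p : Pt m) (u : Pt m) ≤ ε := by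
  refine M.mark_left_of_coord_le h.symm hp.symm hc ?_
  rw [coord_swap (w : Pt m) u, coord_swap (w : Pt m) u]
  linarith

end IsSparseModel

/-! ### Heights along an edge -/

open Classical in
/-- The position of `x` relative to the directed edge `w u` of the tree, where `S` is the side of
`u`. Points close to the edge have their coordinate; the others have a value beyond all these
coordinates, which is above them if `x` is close to an edge within `S`, and below them otherwise. -/
def height (T : SimpleGraph V) (ε : ℝ) (w u : V) (S : Set V) (x : Pt m) : ℝ :=
  if Near ε w u x then coord (w : Pt m) u x
  else if ∃ a b : V, T.Adj a b ∧ Near ε a b x ∧ a ∈ S ∧ b ∈ S then dist (w : Pt m) u + ε + 1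
  else -ε - 1

lemma height_of_near {w u : V} {S : Set V} {x : Pt m} (h : Near ε w u x) :
    height T ε w u S x = coord (w : Pt m) u x := if_pos h

lemma height_of_not_near {w u : V} {S : Set V} {x : Pt m} (h : ¬ Near ε w u x) :
    (height T ε w u S x = dist (w : Pt m) u + ε + 1 ∧
      ∃ a b : V, T.Adj a b ∧ Near ε a b x ∧ a ∈ S ∧ b ∈ S) ∨
    (height T ε w u S x = -ε - 1 ∧
      ¬ ∃ a b : V, T.Adj a b ∧ Near ε a b x ∧ a ∈ S ∧ b ∈ S) := by
  unfold height
  rw [if_neg h]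
  by_cases h' : ∃ a b : V, T.Adj a b ∧ Near ε a b x ∧ a ∈ S ∧ b ∈ S
  · left; rw [if_pos h']; exact ⟨rfl, h'⟩
  · right; rw [if_neg h']; exact ⟨rfl, h'⟩

namespace IsSparseModel

variable (M : IsSparseModel ε γ δ T G hDC)
include M

/-- A point of the sample that is neither near the edge `w u` nor near an edge on the side `S` is near
an edge on the other side. -/
lemma exists_near_notMem {w u : V} {S : Set V} (hS : IsSide T w u S) {c : Pt m} (hc : c ∈ C)
    (hn : ¬ Near ε w u c) (h : ¬ ∃ a b : V, T.Adj a b ∧ Near ε a b c ∧ a ∈ S ∧ b ∈ S) :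
    ∃ a b : V, T.Adj a b ∧ Near ε a b c ∧ a ∉ S ∧ b ∉ S := by
  obtain ⟨a, b, hab, hnear⟩ := M.exists_near hc
  have hne : s(a, b) ≠ s(w, u) := by
    intro e
    rcases Sym2.eq_iff.1 e with ⟨rfl, rfl⟩ | ⟨rfl, rfl⟩
    exacts [hn hnear, hn hnear.symm]
  have hiff := hS.mem_iff a b hab hne
  by_cases ha : a ∈ S
  · exact absurd ⟨a, b, hab, hnear, ha, hiff.1 ha⟩ h
  · exact ⟨a, b, hab, hnear, ha, fun hb => ha (hiff.2 hb)⟩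

lemma pathDist_le_half {w u : V} (h : T.Adj w u) {c : C} {p : D} (hc : Near ε w u c)
    (hp : Near ε w u p) (hd : dist (c : Pt m) (p : Pt m) ≤ ε + cornerRadius T G ε) :
    pathDist G c ⟨p, hDC p.2⟩ ≤ δ / 2 := by
  have h1 := M.approx.pathDist_le w u h c ⟨p, hDC p.2⟩ hc hp
  have h2 := mul_le_mul_of_nonneg_left hd (by linarith [M.one_le] : 0 ≤ γ)
  have h3 := M.le_delta
  simp only at h1
  linarith

lemma pathDist_le_half_of_mark {z a : V} (h : T.Adj z a) {c : C} {p : D} (hc : Near ε z a c)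
    (hp : dist (p : Pt m) (z : Pt m) ≤ ε) (hd : dist (c : Pt m) (z : Pt m) ≤ cornerRadius T G ε) :
    pathDist G c ⟨p, hDC p.2⟩ ≤ δ / 2 :=
  M.pathDist_le_half h hc (mem_offset_left hp) (by
    linarith [dist_triangle_right (c : Pt m) p z])

/-- An edge of `G` that passes a point `p` of `D` on an edge of `T` has both ends close to `p`. -/
lemma pathDist_le_half_of_height {w u : V} {S : Set V} (h : T.Adj w u) (hS : IsSide T w u S)
    {p : D} (hp : Near ε w u p) {c c' : C} (hcc : G.Adj c c')
    (hlt : height T ε w u S c < coord (w : Pt m) u p)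
    (hle : coord (w : Pt m) u p ≤ height T ε w u S c') :
    pathDist G c ⟨p, hDC p.2⟩ ≤ δ / 2 ∧ pathDist G c' ⟨p, hDC p.2⟩ ≤ δ / 2 := by
  have hd := dist_le_maxEdgeLength hcc
  have hd' : dist (c' : Pt m) (c : Pt m) ≤ maxEdgeLength G := by rwa [dist_comm]
  have hp1 := neg_le_coord (ne_of_adj h) hp
  have hp2 := coord_le (ne_of_adj h) hp
  have hR := M.eps_add_le_cornerRadius
  by_cases hc : Near ε w u c <;> by_cases hc' : Near ε w u c'
  · rw [height_of_near hc] at hlt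
    rw [height_of_near hc'] at hle
    have h1 := abs_le.1 ((abs_coord_sub_coord_le (ne_of_adj h) (c : Pt m) c').trans hd)
    constructor
    · refine M.pathDist_le_half h hc hp
        ((dist_le_abs_coord_sub_coord (ne_of_adj h) hc hp).trans ?_)
      have : |coord (w : Pt m) u c - coord (w : Pt m) u p| ≤ maxEdgeLength G :=
        abs_le.2 ⟨by linarith [h1.1], by linarith [maxEdgeLength_nonneg G]⟩
      linarith
    · refine M.pathDist_le_half h hc' hp
        ((dist_le_abs_coord_sub_coord (ne_of_adj h) hc' hp).trans ?_)
      have : |coord (w : Pt m) u c' - coord (w : Pt m) u p| ≤ maxEdgeLength G :=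
        abs_le.2 ⟨by linarith [maxEdgeLength_nonneg G], by linarith [h1.1]⟩
      linarith
  · -- `c'` lies on the side of `u`, so the edge `c c'` turns the corner at `u`
    rw [height_of_near hc] at hlt
    rcases height_of_not_near (T := T) (S := S) hc' with ⟨-, x, y, hxy, hxyc, hx, hy⟩ | ⟨e, -⟩
    · obtain ⟨v, huv, hvc, hv⟩ : ∃ v, T.Adj u v ∧ Near ε u v c' ∧ v ∈ S := by
        rcases M.common_vertex h hxy hc hxyc hd with rfl | rfl | rfl | rfl
        · exact absurd hx hS.left_notMem
        · exact absurd hy hS.left_notMem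
        · exact ⟨y, hxy, hxyc, hy⟩
        · exact ⟨x, hxy.symm, hxyc.symm, hx⟩
      have hwv : w ≠ v := fun e => hS.left_notMem (e ▸ hv)
      have h1 := M.dist_vertex_le h.symm huv hwv hc.symm hvc hd
      have h2 := M.dist_vertex_le huv h.symm hwv.symm hvc hc.symm hd'
      have h3 := M.mark_right_of_le_coord h hp h1 hlt.le
      exact ⟨M.pathDist_le_half_of_mark h.symm hc.symm h3 h1,
        M.pathDist_le_half_of_mark huv hvc h3 h2⟩
    · linarith
  · -- `c` lies on the side of `w`, so the edge `c c'` turns the corner at `w`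
    rw [height_of_near hc'] at hle
    rcases height_of_not_near (T := T) (S := S) hc with ⟨e, -⟩ | ⟨-, hno⟩
    · linarith
    · obtain ⟨x, y, hxy, hxyc, hx, hy⟩ := M.exists_near_notMem hS c.2 hc hno
      obtain ⟨v, hwv, hvc, hv⟩ : ∃ v, T.Adj w v ∧ Near ε w v c ∧ v ∉ S := by
        rcases M.common_vertex h hxy hc' hxyc hd' with rfl | rfl | rfl | rfl
        · exact ⟨y, hxy, hxyc, hy⟩
        · exact ⟨x, hxy.symm, hxyc.symm, hx⟩
        · exact absurd hS.right_mem hx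
        · exact absurd hS.right_mem hy
      have huv : u ≠ v := fun e => hv (e ▸ hS.right_mem)
      have h1 := M.dist_vertex_le h hwv huv hc' hvc hd'
      have h2 := M.dist_vertex_le hwv h huv.symm hvc hc' hd
      have h3 := M.mark_left_of_coord_le h hp h1 hle
      exact ⟨M.pathDist_le_half_of_mark hwv hvc h3 h2,
        M.pathDist_le_half_of_mark h hc' h3 h1⟩
  · exfalso
    rcases height_of_not_near (T := T) (S := S) hc with ⟨e, -⟩ | ⟨-, hno⟩
    · linarith
    rcases height_of_not_near (T := T) (S := S) hc' with ⟨-, x', y', hxy', hxyc', hx', hy'⟩ | ⟨e, -⟩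
    · obtain ⟨x, y, hxy, hxyc, hx, hy⟩ := M.exists_near_notMem hS c.2 hc hno
      rcases M.common_vertex hxy hxy' hxyc hxyc' hd with rfl | rfl | rfl | rfl
      exacts [hx hx', hx hy', hy hx', hy hy']
    · linarith

/-- A point of `D` that separates `a` from `b` is closer to both than they are to each other:
every path from `a` to `b` passes within distance `δ / 2` of it. -/
lemma pathDistOn_lt_of_height {w u : V} {S : Set V} (h : T.Adj w u) (hS : IsSide T w u S)
    {p a b : D} (hp : Near ε w u p) (ha : height T ε w u S a < coord (w : Pt m) u p)
    (hb : coord (w : Pt m) u p < height T ε w u S b) :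
    pathDistOn G hDC a p < pathDistOn G hDC a b ∧ pathDistOn G hDC p b < pathDistOn G hDC a b := by
  have hG := M.approx.connected
  have hpa : a ≠ p := by
    rintro rfl
    rw [height_of_near hp] at ha
    exact lt_irrefl _ ha
  have hpb : p ≠ b := by
    rintro rfl
    rw [height_of_near hp] at hb
    exact lt_irrefl _ hb
  have h1 : δ ≤ pathDist G ⟨a, hDC a.2⟩ ⟨p, hDC p.2⟩ := M.sparse a p hpa
  have h2 : δ ≤ pathDist G ⟨p, hDC p.2⟩ ⟨b, hDC b.2⟩ := M.sparse p b hpb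
  have key : ∀ r, r ≤ pathDist G ⟨a, hDC a.2⟩ ⟨p, hDC p.2⟩ + pathDist G ⟨p, hDC p.2⟩ ⟨b, hDC b.2⟩
      - δ → r < pathDist G ⟨a, hDC a.2⟩ ⟨b, hDC b.2⟩ := by
    intro r hr
    refine lt_pathDist_of_boundary hG
      (fun c : C => height T ε w u S (c : Pt m) < coord (w : Pt m) u p)
      (a := ⟨a, hDC a.2⟩) (b := ⟨b, hDC b.2⟩) ha (not_lt.2 hb.le) ?_
    intro c c' hcc hc hc'
    obtain ⟨h3, h4⟩ := M.pathDist_le_half_of_height h hS hp hcc hc (not_lt.1 hc')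
    have h5 := pathDist_triangle hG ⟨a, hDC a.2⟩ c ⟨p, hDC p.2⟩
    have h6 := pathDist_triangle hG ⟨p, hDC p.2⟩ c' ⟨b, hDC b.2⟩
    rw [pathDist_comm ⟨p, hDC p.2⟩ c'] at h6
    linarith
  constructor <;>
  · unfold pathDistOn
    exact key _ (by linarith)

end IsSparseModel

end Sparse

/-! ### The edges of a minimum spanning tree -/

/-- In a sequence of points on the line, two intervals between consecutive points that are not the
same interval meet at most in a common endpoint. -/
lemma exists_common_of_mem_segment {X : Type*} {N : Set X} {t : X → ℝ} (ht : Set.InjOn t N)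
    {a b c d : X} (ha : a ∈ N) (hb : b ∈ N) (hc : c ∈ N) (hd : d ∈ N)
    (hab : ∀ p ∈ N, ¬ (t a < t p ∧ t p < t b)) (hba : ∀ p ∈ N, ¬ (t b < t p ∧ t p < t a))
    (hcd : ∀ p ∈ N, ¬ (t c < t p ∧ t p < t d)) (hdc : ∀ p ∈ N, ¬ (t d < t p ∧ t p < t c))
    (hne : s(a, b) ≠ s(c, d)) {τ : ℝ} (h1 : τ ∈ segment ℝ (t a) (t b))
    (h2 : τ ∈ segment ℝ (t c) (t d)) : ∃ v, (v = a ∨ v = b) ∧ (v = c ∨ v = d) ∧ τ = t v := by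
  wlog h : t a ≤ t b generalizing a b
  · obtain ⟨v, hv, hv', hτ⟩ := this hb ha hba hab (by rwa [Sym2.eq_swap])
      (by rwa [segment_symm]) (le_of_not_ge h)
    exact ⟨v, hv.symm, hv', hτ⟩
  wlog h' : t c ≤ t d generalizing c d
  · obtain ⟨v, hv, hv', hτ⟩ := this hd hc hdc hcd (by rwa [segment_symm])
      (by rwa [Sym2.eq_swap (a := d)]) (le_of_not_ge h')
    exact ⟨v, hv, hv'.symm, hτ⟩
  rw [segment_eq_Icc h] at h1
  rw [segment_eq_Icc h'] at h2
  -- an endpoint of one interval that lies in the other one is an endpoint of the latter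
  have key : ∀ x y z, x ∈ N → y ∈ N → z ∈ N → ¬ (t x < t z ∧ t z < t y) → t x ≤ t z →
      t z ≤ t y → z = x ∨ z = y := by
    intro x y z hx hy hz hn hxz hzy
    rcases hxz.lt_or_eq with h | h
    · rcases hzy.lt_or_eq with h' | h'
      · exact absurd ⟨h, h'⟩ hn
      · exact Or.inr (ht hz hy h')
    · exact Or.inl (ht hz hx h.symm)
  rcases h1.1.lt_or_eq with l1 | e
  · rcases h1.2.lt_or_eq with l2 | e
    · rcases h2.1.lt_or_eq with l3 | e
      · rcases h2.2.lt_or_eq with l4 | e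
        · exfalso
          have e1 : a = c := ht ha hc (le_antisymm
            (not_lt.1 fun hlt => hab c hc ⟨hlt, l3.trans l2⟩)
            (not_lt.1 fun hlt => hcd a ha ⟨hlt, l1.trans l4⟩)).symm
          have e2 : b = d := ht hb hd (le_antisymm
            (not_lt.1 fun hlt => hab d hd ⟨l1.trans l4, hlt⟩)
            (not_lt.1 fun hlt => hcd b hb ⟨l3.trans l2, hlt⟩))
          exact hne (by rw [e1, e2])
        · exact ⟨d, key a b d ha hb hd (hab d hd) (e ▸ h1.1) (e ▸ h1.2), Or.inr rfl, e⟩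
      · exact ⟨c, key a b c ha hb hc (hab c hc) (e ▸ h1.1) (e ▸ h1.2), Or.inl rfl, e.symm⟩
    · exact ⟨b, Or.inr rfl, key c d b hc hd hb (hcd b hb) (e ▸ h2.1) (e ▸ h2.2), e⟩
  · exact ⟨a, Or.inl rfl, key c d a hc hd ha (hcd a ha) (e ▸ h2.1) (e ▸ h2.2), e.symm⟩

section SpanningTree

variable {m : ℕ} {ε γ δ : ℝ} {V C D : Finset (Pt m)} {T : SimpleGraph V} {G : SimpleGraph C}
  {hDC : D ⊆ C} {W : SimpleGraph D}

lemma segment_congr {w u x y : V} (h : s(w, u) = s(x, y)) :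
    segment ℝ (w : Pt m) (u : Pt m) = segment ℝ (x : Pt m) (y : Pt m) := by
  rcases Sym2.eq_iff.1 h with ⟨rfl, rfl⟩ | ⟨rfl, rfl⟩
  exacts [rfl, segment_symm ℝ _ _]

lemma Near.congr {w u x y : V} (h : s(w, u) = s(x, y)) {p : Pt m} (hp : Near ε w u p) :
    Near ε x y p := by
  rwa [Near, ← segment_congr h]

namespace IsSparseModel

variable (M : IsSparseModel ε γ δ T G hDC)
include M

/-- Two distinct edges of `T` that are both close to a point form a corner. -/
lemma exists_corner {w u x y : V} (h : T.Adj w u) (h' : T.Adj x y) (hne : s(w, u) ≠ s(x, y))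
    {c : Pt m} (hc : Near ε w u c) (hc' : Near ε x y c) :
    ∃ z a b, T.Adj z a ∧ T.Adj z b ∧ a ≠ b ∧ s(w, u) = s(z, a) ∧ s(x, y) = s(z, b) := by
  rcases M.common_vertex h h' hc hc' (by rw [dist_self]; exact maxEdgeLength_nonneg G)
    with rfl | rfl | rfl | rfl
  · exact ⟨w, u, y, h, h', by rintro rfl; exact hne rfl, rfl, rfl⟩
  · exact ⟨w, u, x, h, h'.symm, by rintro rfl; exact hne Sym2.eq_swap, rfl, Sym2.eq_swap⟩
  · exact ⟨u, w, y, h.symm, h', by rintro rfl; exact hne Sym2.eq_swap, Sym2.eq_swap, rfl⟩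
  · exact ⟨u, w, x, h.symm, h'.symm, by rintro rfl; exact hne rfl, Sym2.eq_swap, Sym2.eq_swap⟩

lemma not_between_height (hW : IsMST (pathDistOn G hDC) W) {a b p : D} (hab : W.Adj a b) {w u : V}
    {S : Set V} (h : T.Adj w u) (hS : IsSide T w u S) (hp : Near ε w u p)
    (ha : height T ε w u S a < coord (w : Pt m) u p)
    (hb : coord (w : Pt m) u p < height T ε w u S b) : False := by
  obtain ⟨h1, h2⟩ := M.pathDistOn_lt_of_height h hS hp ha hb
  exact hW.not_lt_and_lt (fun _ _ => pathDist_nonneg _ _) (fun _ _ => pathDist_comm _ _) hab h1 h2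

lemma not_between_coord (hW : IsMST (pathDistOn G hDC) W) {a b p : D} (hab : W.Adj a b) {w u : V}
    (h : T.Adj w u) (ha : Near ε w u a) (hb : Near ε w u b) (hp : Near ε w u p) :
    ¬ (coord (w : Pt m) u a < coord (w : Pt m) u p ∧
      coord (w : Pt m) u p < coord (w : Pt m) u b) := by
  rintro ⟨h1, h2⟩
  refine M.not_between_height hW hab h (isSide_reachable M.tree.isTree.isAcyclic h) hp ?_ ?_
  · rwa [height_of_near ha]
  · rwa [height_of_near hb]

/-- An edge of a minimum spanning tree can leave the offset of an edge of `T` only at a mark of a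
vertex. -/
lemma exists_mark_of_not_near (hW : IsMST (pathDistOn G hDC) W) {a b : D} (hab : W.Adj a b)
    {w u : V} (h : T.Adj w u) (ha : Near ε w u a) (hb : ¬ Near ε w u b) :
    ∃ z : V, dist (a : Pt m) (z : Pt m) ≤ ε := by
  by_contra! hno
  have hS := isSide_reachable M.tree.isTree.isAcyclic h
  have hR := M.eps_lt_cornerRadius
  have hε := M.eps_nonneg
  rcases height_of_not_near (T := T) (S := {x | (T.deleteEdges {s(w, u)}).Reachable u x}) hb
    with ⟨e, -⟩ | ⟨e, -⟩
  · obtain ⟨q, hq⟩ := M.exists_mark u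
    have hne : a ≠ q := by rintro rfl; exact (hno u).not_ge hq
    have hqn : Near ε w u q := mem_offset_right hq
    have h1 := M.coord_mark_right h ha hq hne
    have h2 := coord_le (ne_of_adj h) hqn
    refine M.not_between_height hW hab h hS hqn ?_ ?_
    · rw [height_of_near ha]; linarith
    · rw [e]; linarith
  · obtain ⟨q, hq⟩ := M.exists_mark w
    have hne : a ≠ q := by rintro rfl; exact (hno w).not_ge hq
    have hqn : Near ε w u q := mem_offset_left hq
    have h1 := M.coord_mark_left h ha hq hne
    have h2 := neg_le_coord (ne_of_adj h) hqn
    refine M.not_between_height hW hab.symm h hS hqn ?_ ?_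
    · rw [e]; linarith
    · rw [height_of_near ha]; linarith

/-- The ends of an edge of a minimum spanning tree are close to one and the same edge of `T`. -/
lemma exists_near_near (hW : IsMST (pathDistOn G hDC) W) {a b : D} (hab : W.Adj a b) :
    ∃ w u, T.Adj w u ∧ Near ε w u a ∧ Near ε w u b := by
  obtain ⟨w, u, h, ha⟩ := M.exists_near (hDC a.2)
  by_cases hb : Near ε w u b
  · exact ⟨w, u, h, ha, hb⟩
  obtain ⟨z, hz⟩ := M.exists_mark_of_not_near hW hab h ha hb
  obtain ⟨x, y, hxy, hxyb, hzx⟩ : ∃ x y, T.Adj x y ∧ Near ε x y b ∧ z ≠ x := by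
    obtain ⟨x, y, hxy, hxyb⟩ := M.exists_near (hDC b.2)
    by_cases hzx : z = x
    · exact ⟨y, x, hxy.symm, hxyb.symm, fun e => hxy.ne (hzx.symm.trans e)⟩
    · exact ⟨x, y, hxy, hxyb, hzx⟩
  obtain ⟨v, S, hzv, hS, hxS⟩ := exists_isSide_mem M.tree.isTree hzx
  have han : Near ε z v a := mem_offset_left hz
  refine ⟨z, v, hzv, han, ?_⟩
  by_contra hbn
  -- otherwise the mark of `v` separates `a` from `b`
  have hyS : y ∈ S := (hS.mem_iff x y hxy fun e => hbn (hxyb.congr e)).1 hxS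
  rcases height_of_not_near (T := T) (S := S) hbn with ⟨e, -⟩ | ⟨-, hno⟩
  · obtain ⟨q, hq⟩ := M.exists_mark v
    have hqn : Near ε z v q := mem_offset_right hq
    have hne : q ≠ a := by rintro rfl; exact M.not_mark_both hzv hz hq
    have h1 := M.coord_mark_left hzv hqn hz hne
    have h2 := coord_le (ne_of_adj hzv) hqn
    refine M.not_between_height hW hab hzv hS hqn ?_ ?_
    · rw [height_of_near han]; linarith [M.eps_lt_cornerRadius, M.eps_nonneg]
    · rw [e]; linarith
  · exact hno ⟨x, y, hxy, hxyb, hxS, hyS⟩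

lemma injOn_coord {w u : V} (h : T.Adj w u) :
    Set.InjOn (fun a : D => coord (w : Pt m) u (a : Pt m)) {a | Near ε w u a} :=
  fun _ ha _ hb hab => M.coord_injective h ha hb hab

/-- If a segment between points of `D` along an edge of `T` comes close to a vertex, one of its
ends marks that vertex. -/
lemma mark_of_mem_segment {w u : V} (h : T.Adj w u) {a b : D} (ha : Near ε w u a)
    (hb : Near ε w u b) {x : Pt m} (hx : x ∈ segment ℝ (a : Pt m) (b : Pt m))
    (hxw : dist x (w : Pt m) ≤ ε / Real.sin (minAngle T / 2)) :
    dist (a : Pt m) (w : Pt m) ≤ ε ∨ dist (b : Pt m) (w : Pt m) ≤ ε := by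
  by_contra! hno
  obtain ⟨q, hq⟩ := M.exists_mark w
  have h1 := M.coord_mark_left h ha hq (by rintro rfl; exact hno.1.not_ge hq)
  have h2 := M.coord_mark_left h hb hq (by rintro rfl; exact hno.2.not_ge hq)
  have h3 := neg_le_coord (ne_of_adj h) (mem_offset_left hq : Near ε w u q)
  have h4 := abs_le.1 ((abs_coord_sub_coord_le (ne_of_adj h) x w).trans hxw)
  have h5 := (convex_Ici (-ε + 2 * cornerRadius T G ε)).segment_subset
    (Set.mem_Ici.2 (by linarith)) (Set.mem_Ici.2 (by linarith))
    (coord_mem_segment (w : Pt m) u hx)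
  rw [coord_left] at h4
  rw [Set.mem_Ici] at h5
  linarith [h4.2, M.div_add_le_cornerRadius, M.maxEdgeLength_pos, M.eps_lt_cornerRadius]

/-- Two segments that start at the mark of a vertex along different edges of `T` meet in this mark
only: otherwise the end of the shorter one would be close to both edges. -/
lemma eq_of_mem_segment_of_mem_segment {z u v : V} (hu : T.Adj z u) (hv : T.Adj z v) (huv : u ≠ v)
    {p b d : D} (hp : dist (p : Pt m) (z : Pt m) ≤ ε) (hpb : p ≠ b) (hpd : p ≠ d)
    (hb : Near ε z u b) (hd : Near ε z v d) {x : Pt m}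
    (hxb : x ∈ segment ℝ (p : Pt m) (b : Pt m)) (hxd : x ∈ segment ℝ (p : Pt m) (d : Pt m)) :
    x = p := by
  by_contra hxp
  rw [segment_eq_image'] at hxb hxd
  obtain ⟨s, hs, rfl⟩ := hxb
  obtain ⟨t, ht, hst⟩ := hxd
  have hst : t • ((d : Pt m) - p) = s • ((b : Pt m) - p) := add_left_cancel hst
  have hs0 : 0 < s := hs.1.lt_of_ne (by rintro rfl; simp at hxp)
  have ht0 : 0 < t := ht.1.lt_of_ne (by
    rintro rfl
    refine hxp ?_
    simp only [← hst, zero_smul, add_zero])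
  rcases le_total s t with h | h
  · have hmem : (d : Pt m) ∈ segment ℝ (p : Pt m) (b : Pt m) := by
      rw [segment_eq_image']
      refine ⟨t⁻¹ * s, ⟨by positivity, ?_⟩, ?_⟩
      · rw [inv_mul_le_iff₀ ht0]; linarith
      · simp only [mul_smul, ← hst]
        rw [inv_smul_smul₀ ht0.ne', add_sub_cancel]
    have hdu : Near ε z u d :=
      (convex_offset_segment _ _ _).segment_subset (mem_offset_left hp) hb hmem
    exact hpd (M.mark_unique hp (M.mark_of_near_of_near hu hv huv hdu hd))
  · have hmem : (b : Pt m) ∈ segment ℝ (p : Pt m) (d : Pt m) := by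
      rw [segment_eq_image']
      refine ⟨s⁻¹ * t, ⟨by positivity, ?_⟩, ?_⟩
      · rw [inv_mul_le_iff₀ hs0]; linarith
      · simp only [mul_smul, hst]
        rw [inv_smul_smul₀ hs0.ne', add_sub_cancel]
    have hbv : Near ε z v b :=
      (convex_offset_segment _ _ _).segment_subset (mem_offset_left hp) hd hmem
    exact hpb (M.mark_unique hp (M.mark_of_near_of_near hu hv huv hb hbv))

/-- The straight-line drawing of a minimum spanning tree has no crossings. -/
lemma isEmbeddedBy_coe (hW : IsMST (pathDistOn G hDC) W) :
    IsEmbeddedBy W (fun a : D => (a : Pt m)) where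
  ne a b hab := ne_of_adj hab
  inter := by
    intro a b c d hab hcd hne x hx hx'
    obtain ⟨w, u, h, ha, hb⟩ := M.exists_near_near hW hab
    obtain ⟨w', u', h', hc, hd⟩ := M.exists_near_near hW hcd
    by_cases he : s(w, u) = s(w', u')
    · replace hc := hc.congr he.symm
      replace hd := hd.congr he.symm
      obtain ⟨v, hv, hv', hτ⟩ := exists_common_of_mem_segment (M.injOn_coord h) ha hb hc hd
        (fun p hp => M.not_between_coord hW hab h ha hb hp)
        (fun p hp => M.not_between_coord hW hab.symm h hb ha hp)
        (fun p hp => M.not_between_coord hW hcd h hc hd hp)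
        (fun p hp => M.not_between_coord hW hcd.symm h hd hc hp) hne
        (coord_mem_segment (w : Pt m) u hx) (coord_mem_segment (w : Pt m) u hx')
      refine ⟨v, hv, hv', ?_⟩
      have hcne : coord (w : Pt m) u a ≠ coord (w : Pt m) u b :=
        fun e => hab.ne (M.coord_injective h ha hb e)
      rcases hv with rfl | rfl
      · exact eq_of_coord_eq hx hcne hτ
      · exact eq_of_coord_eq (segment_symm ℝ (a : Pt m) v ▸ hx) hcne.symm hτ
    · have hxn := (convex_offset_segment _ _ _).segment_subset ha hb hx
      have hxn' := (convex_offset_segment _ _ _).segment_subset hc hd hx'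
      obtain ⟨z, u₁, u₂, h₁, h₂, hu, e₁, e₂⟩ := M.exists_corner h h' he hxn hxn'
      have hz := M.dist_vertex_le_div h₁ h₂ hu (Near.congr e₁ hxn) (Near.congr e₂ hxn')
      have hz₁ := M.mark_of_mem_segment h₁ (ha.congr e₁) (hb.congr e₁) hx hz
      have hz₂ := M.mark_of_mem_segment h₂ (hc.congr e₂) (hd.congr e₂) hx' hz
      obtain ⟨p, q, hpq, hp, hp', hqn, hxp⟩ : ∃ p q : D, p ≠ q ∧ (p = a ∨ p = b) ∧
          dist (p : Pt m) (z : Pt m) ≤ ε ∧ Near ε z u₁ q ∧ x ∈ segment ℝ (p : Pt m) (q : Pt m) := by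
        rcases hz₁ with hz₁ | hz₁
        · exact ⟨a, b, hab.ne, Or.inl rfl, hz₁, hb.congr e₁, hx⟩
        · exact ⟨b, a, hab.ne.symm, Or.inr rfl, hz₁, ha.congr e₁, by rwa [segment_symm]⟩
      obtain ⟨p', q', hpq', hr, hr', hqn', hxp'⟩ : ∃ p q : D, p ≠ q ∧ (p = c ∨ p = d) ∧
          dist (p : Pt m) (z : Pt m) ≤ ε ∧ Near ε z u₂ q ∧ x ∈ segment ℝ (p : Pt m) (q : Pt m) := by
        rcases hz₂ with hz₂ | hz₂
        · exact ⟨c, d, hcd.ne, Or.inl rfl, hz₂, hd.congr e₂, hx'⟩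
        · exact ⟨d, c, hcd.ne.symm, Or.inr rfl, hz₂, hc.congr e₂, by rwa [segment_symm]⟩
      obtain rfl := M.mark_unique hp' hr'
      exact ⟨p, hp, hr, M.eq_of_mem_segment_of_mem_segment h₁ h₂ hu hp' hpq hpq' hqn hqn' hxp hxp'⟩

end IsSparseModel

end SpanningTree

/-! ### Placing the points of the sparse set on the tree -/

section Placement

variable {m : ℕ} {ε γ δ : ℝ} {V C D : Finset (Pt m)} {T : SimpleGraph V} {G : SimpleGraph C}
  {hDC : D ⊆ C} {W : SimpleGraph D}

/-- The coordinate of `x` along the edge `w u`, rescaled so that the marks `P w` and `P u` of its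
ends have the values `0` and `1`. -/
def edgeRatio (P : V → D) (w u : V) (x : D) : ℝ :=
  (coord (w : Pt m) u x - coord (w : Pt m) u (P w)) /
    (coord (w : Pt m) u (P u) - coord (w : Pt m) u (P w))

lemma edgeRatio_left (P : V → D) (w u : V) : edgeRatio P w u (P w) = 0 := by simp [edgeRatio]

namespace IsSparseModel

variable (M : IsSparseModel ε γ δ T G hDC)
include M

section

variable {P : V → D} (hP : ∀ v, dist (P v : Pt m) (v : Pt m) ≤ ε)
include hP

lemma coord_marks_lt {w u : V} (h : T.Adj w u) :
    coord (w : Pt m) u (P w) < coord (w : Pt m) u (P u) := by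
  have hne : P u ≠ P w := fun e => M.not_mark_both h (hP w) (e ▸ hP u)
  have := M.coord_mark_left h (mem_offset_right (hP u)) (hP w) hne
  linarith [M.eps_lt_cornerRadius, M.eps_nonneg]

lemma edgeRatio_swap {w u : V} (h : T.Adj w u) (x : D) :
    edgeRatio P u w x = 1 - edgeRatio P w u x := by
  have h1 := (sub_pos.2 (M.coord_marks_lt hP h)).ne'
  have h2 : coord (u : Pt m) w (P w) - coord (u : Pt m) w (P u) =
      coord (w : Pt m) u (P u) - coord (w : Pt m) u (P w) := by
    rw [coord_swap (w : Pt m) u, coord_swap (w : Pt m) u]; ring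
  rw [edgeRatio, edgeRatio, h2, eq_sub_iff_add_eq, ← add_div, div_eq_one_iff_eq h1,
    coord_swap (w : Pt m) u, coord_swap (w : Pt m) u]
  ring

lemma edgeRatio_lt_iff {w u : V} (h : T.Adj w u) {x y : D} :
    edgeRatio P w u x < edgeRatio P w u y ↔ coord (w : Pt m) u x < coord (w : Pt m) u y := by
  rw [edgeRatio, edgeRatio, div_lt_div_iff_of_pos_right (sub_pos.2 (M.coord_marks_lt hP h)),
    sub_lt_sub_iff_right]

lemma injOn_edgeRatio {w u : V} (h : T.Adj w u) :
    Set.InjOn (edgeRatio P w u) {a | Near ε w u a} := by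
  intro a ha b hb hab
  refine M.coord_injective h ha hb (le_antisymm ?_ ?_)
  · exact not_lt.1 fun hlt => ((M.edgeRatio_lt_iff hP h).2 hlt).ne' hab
  · exact not_lt.1 fun hlt => ((M.edgeRatio_lt_iff hP h).2 hlt).ne hab

lemma edgeRatio_nonneg {w u : V} (h : T.Adj w u) {x : D} (hx : Near ε w u x) :
    0 ≤ edgeRatio P w u x := by
  rw [← edgeRatio_left P w u, ← not_lt, M.edgeRatio_lt_iff hP h, not_lt]
  by_cases hne : x = P w
  · rw [hne]
  · have := M.coord_mark_left h hx (hP w) hne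
    linarith [M.eps_lt_cornerRadius, M.eps_nonneg]

lemma edgeRatio_le_one {w u : V} (h : T.Adj w u) {x : D} (hx : Near ε w u x) :
    edgeRatio P w u x ≤ 1 := by
  have := M.edgeRatio_nonneg hP h.symm hx.symm
  rw [M.edgeRatio_swap hP h] at this
  linarith

/-- The rescaled coordinates along the edges of `T` define a map of `D` to `T`; they agree for a
point close to several edges, since such a point marks a vertex. -/
lemma exists_placement : ∃ π : D → Pt m, ∀ (w u : V) (a : D), T.Adj w u → Near ε w u a →
    π a = AffineMap.lineMap (w : Pt m) (u : Pt m) (edgeRatio P w u a) := by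
  have key : ∀ (a : D) (w u x y : V), T.Adj w u → T.Adj x y → Near ε w u a → Near ε x y a →
      (AffineMap.lineMap (w : Pt m) (u : Pt m) (edgeRatio P w u a) : Pt m) =
        AffineMap.lineMap (x : Pt m) (y : Pt m) (edgeRatio P x y a) := by
    have hswap : ∀ (a : D) (w u : V), T.Adj w u →
        (AffineMap.lineMap (w : Pt m) (u : Pt m) (edgeRatio P w u a) : Pt m) =
          AffineMap.lineMap (u : Pt m) (w : Pt m) (edgeRatio P u w a) := by
      intro a w u h
      rw [M.edgeRatio_swap hP h, AffineMap.lineMap_apply_one_sub]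
    have hcongr : ∀ (a : D) (w u x y : V), T.Adj w u → s(w, u) = s(x, y) →
        (AffineMap.lineMap (w : Pt m) (u : Pt m) (edgeRatio P w u a) : Pt m) =
          AffineMap.lineMap (x : Pt m) (y : Pt m) (edgeRatio P x y a) := by
      intro a w u x y h e
      rcases Sym2.eq_iff.1 e with ⟨rfl, rfl⟩ | ⟨rfl, rfl⟩
      exacts [rfl, hswap a w u h]
    intro a w u x y h h' ha ha'
    by_cases e : s(w, u) = s(x, y)
    · exact hcongr a w u x y h e
    · obtain ⟨z, u₁, u₂, h₁, h₂, hu, e₁, e₂⟩ := M.exists_corner h h' e ha ha'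
      have hz := M.mark_of_near_of_near h₁ h₂ hu (ha.congr e₁) (ha'.congr e₂)
      obtain rfl := M.mark_unique (hP z) hz
      rw [hcongr _ w u z u₁ h e₁, hcongr _ x y z u₂ h' e₂, edgeRatio_left, edgeRatio_left,
        AffineMap.lineMap_apply_zero, AffineMap.lineMap_apply_zero]
  choose w u h ha using fun a : D => M.exists_near (hDC a.2)
  exact ⟨fun a => AffineMap.lineMap (w a : Pt m) (u a : Pt m) (edgeRatio P (w a) (u a) a),
    fun x y a hxy hn => key a _ _ _ _ (h a) hxy (ha a) hn⟩

section

variable {π : D → Pt m} (hπ : ∀ (w u : V) (a : D), T.Adj w u → Near ε w u a →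
  π a = AffineMap.lineMap (w : Pt m) (u : Pt m) (edgeRatio P w u a))
include hπ

lemma placement_mark (z : V) : π (P z) = z := by
  obtain ⟨u, hu⟩ := M.exists_adj z
  rw [hπ z u _ hu (mem_offset_left (hP z)), edgeRatio_left, AffineMap.lineMap_apply_zero]

lemma placement_mem_segment {w u : V} {a : D} (h : T.Adj w u) (ha : Near ε w u a) :
    π a ∈ segment ℝ (w : Pt m) (u : Pt m) := by
  rw [hπ w u a h ha, segment_eq_image_lineMap]
  exact ⟨_, ⟨M.edgeRatio_nonneg hP h ha, M.edgeRatio_le_one hP h ha⟩, rfl⟩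

omit M hP in
lemma exists_lineMap_eq {w u : V} {a b : D} (h : T.Adj w u) (ha : Near ε w u a)
    (hb : Near ε w u b) {x : Pt m} (hx : x ∈ segment ℝ (π a) (π b)) :
    ∃ τ ∈ segment ℝ (edgeRatio P w u a) (edgeRatio P w u b),
      AffineMap.lineMap (w : Pt m) (u : Pt m) τ = x := by
  rw [hπ w u a h ha, hπ w u b h hb, ← image_segment ℝ (AffineMap.lineMap (w : Pt m) (u : Pt m))]
    at hx
  exact hx

/-- A vertex of `T` on the image of an edge of the spanning tree is the image of its mark. -/
lemma eq_mark_of_mem_segment {z u : V} {a b : D} (h : T.Adj z u) (ha : Near ε z u a)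
    (hb : Near ε z u b) (hz : (z : Pt m) ∈ segment ℝ (π a) (π b)) : P z = a ∨ P z = b := by
  obtain ⟨τ, hτ, e⟩ := exists_lineMap_eq hπ h ha hb hz
  have hτ0 : τ = 0 := AffineMap.lineMap_injective ℝ (ne_of_adj h)
    (e.trans (AffineMap.lineMap_apply_zero _ _).symm)
  subst hτ0
  have hPz : Near ε z u (P z) := mem_offset_left (hP z)
  have ha0 := M.edgeRatio_nonneg hP h ha
  have hb0 := M.edgeRatio_nonneg hP h hb
  rcases ha0.eq_or_lt with h0 | h0
  · exact Or.inl (M.injOn_edgeRatio hP h hPz ha (by rw [edgeRatio_left, h0]))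
  rcases hb0.eq_or_lt with h1 | h1
  · exact Or.inr (M.injOn_edgeRatio hP h hPz hb (by rw [edgeRatio_left, h1]))
  · exact absurd ((convex_Ioi (0 : ℝ)).segment_subset h0 h1 hτ) (lt_irrefl (0 : ℝ))

/-- The spanning tree placed on `T` has no crossings. -/
lemma isEmbeddedBy_placement (hW : IsMST (pathDistOn G hDC) W) : IsEmbeddedBy W π where
  ne a b hab e := by
    obtain ⟨w, u, h, ha, hb⟩ := M.exists_near_near hW hab
    rw [hπ w u a h ha, hπ w u b h hb] at e
    exact hab.ne (M.injOn_edgeRatio hP h ha hb (AffineMap.lineMap_injective ℝ (ne_of_adj h) e))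
  inter := by
    intro a b c d hab hcd hne x hx hx'
    obtain ⟨w, u, h, ha, hb⟩ := M.exists_near_near hW hab
    obtain ⟨w', u', h', hc, hd⟩ := M.exists_near_near hW hcd
    by_cases he : s(w, u) = s(w', u')
    · replace hc := hc.congr he.symm
      replace hd := hd.congr he.symm
      obtain ⟨τ, hτ, e⟩ := exists_lineMap_eq hπ h ha hb hx
      obtain ⟨τ', hτ', e'⟩ := exists_lineMap_eq hπ h hc hd hx'
      obtain rfl := AffineMap.lineMap_injective ℝ (ne_of_adj h) (e.trans e'.symm)
      have hgap : ∀ a b : D, W.Adj a b → Near ε w u a → Near ε w u b →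
          ∀ p ∈ {p : D | Near ε w u p}, ¬ (edgeRatio P w u a < edgeRatio P w u p ∧
            edgeRatio P w u p < edgeRatio P w u b) := by
        intro a b hab ha hb p hp
        rw [M.edgeRatio_lt_iff hP h, M.edgeRatio_lt_iff hP h]
        exact M.not_between_coord hW hab h ha hb hp
      obtain ⟨v, hv, hv', hτv⟩ := exists_common_of_mem_segment (M.injOn_edgeRatio hP h)
        ha hb hc hd (hgap a b hab ha hb) (hgap b a hab.symm hb ha) (hgap c d hcd hc hd)
        (hgap d c hcd.symm hd hc) hne hτ hτ'
      refine ⟨v, hv, hv', ?_⟩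
      have hvn : Near ε w u v := by rcases hv with rfl | rfl <;> assumption
      rw [hπ w u v h hvn, ← e, hτv]
    · have hsub := (convex_segment (w : Pt m) (u : Pt m)).segment_subset
        (M.placement_mem_segment hP hπ h ha) (M.placement_mem_segment hP hπ h hb) hx
      have hsub' := (convex_segment (w' : Pt m) (u' : Pt m)).segment_subset
        (M.placement_mem_segment hP hπ h' hc) (M.placement_mem_segment hP hπ h' hd) hx'
      have hε := M.eps_nonneg
      obtain ⟨z, u₁, u₂, h₁, h₂, hu, e₁, e₂⟩ := M.exists_corner h h' he
        ⟨x, hsub, by rwa [dist_self]⟩ ⟨x, hsub', by rwa [dist_self]⟩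
      rw [segment_congr e₁] at hsub
      rw [segment_congr e₂] at hsub'
      have hxz : x = z := by
        obtain ⟨hl | hl, hr⟩ := M.tree.embedded z u₁ z u₂ h₁ h₂ (e₁ ▸ e₂ ▸ he) x hsub hsub'
        · exact hl
        · rcases hr with hr | hr
          · exact hr
          · exact absurd (Subtype.ext (hl.symm.trans hr)) hu
      rw [hxz] at hx hx'
      have k₁ := M.eq_mark_of_mem_segment hP hπ h₁ (ha.congr e₁) (hb.congr e₁) hx
      have k₂ := M.eq_mark_of_mem_segment hP hπ h₂ (hc.congr e₂) (hd.congr e₂) hx'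
      exact ⟨P z, k₁, k₂, by rw [M.placement_mark hP hπ, hxz]⟩

/-- The spanning tree, placed on `T`, covers every edge of `T`: it is connected, so some edge of it
passes over any given point, and the marks keep the ends of that edge on the same edge of `T`. -/
lemma segment_subset_edgeUnion (hW : IsMST (pathDistOn G hDC) W) {w u : V} (h : T.Adj w u) :
    segment ℝ (w : Pt m) (u : Pt m) ⊆ edgeUnion W π := by
  intro x hx
  rw [segment_eq_image_lineMap] at hx
  obtain ⟨σ, ⟨hσ0, hσ1⟩, rfl⟩ := hx
  have hD := M.nontrivial
  have hconn := hW.1.connected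
  have hvertex : ∀ p : D, π p ∈ edgeUnion W π := by
    intro p
    obtain ⟨q, hq⟩ := hconn.preconnected.exists_adj_of_nontrivial p
    exact ⟨p, q, hq, left_mem_segment ℝ _ _⟩
  have hw : Near ε w u (P w) := mem_offset_left (hP w)
  have hu : Near ε w u (P u) := mem_offset_right (hP u)
  rcases hσ0.eq_or_lt with rfl | hσ0
  · rw [AffineMap.lineMap_apply_zero, ← M.placement_mark hP hπ w]
    exact hvertex _
  rcases hσ1.eq_or_lt with rfl | hσ1
  · rw [AffineMap.lineMap_apply_one, ← M.placement_mark hP hπ u]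
    exact hvertex _
  have hlt := sub_pos.2 (M.coord_marks_lt hP h)
  -- the coordinate at which the rescaled coordinate is `σ`
  set τ := coord (w : Pt m) u (P w) +
    σ * (coord (w : Pt m) u (P u) - coord (w : Pt m) u (P w)) with hτ
  have hτ0 : coord (w : Pt m) u (P w) < τ := by
    have := mul_pos hσ0 hlt
    linarith
  have hτ1 : τ < coord (w : Pt m) u (P u) := by
    have := mul_lt_mul_of_pos_right hσ1 hlt
    linarith
  have hlow := neg_le_coord (ne_of_adj h) hw
  have hhigh := coord_le (ne_of_adj h) hu
  have hS := isSide_reachable M.tree.isTree.isAcyclic h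
  set S := {x | (T.deleteEdges {s(w, u)}).Reachable u x}
  obtain ⟨walk⟩ := hconn (P w) (P u)
  obtain ⟨⟨⟨a, b⟩, hab⟩, -, ha, hb⟩ := walk.exists_boundary_dart
    {c : D | height T ε w u S (c : Pt m) < τ}
    (by rw [Set.mem_ofPred_eq, height_of_near hw]; exact hτ0)
    (by rw [Set.mem_ofPred_eq, height_of_near hu]; exact hτ1.le.not_gt)
  replace ha : height T ε w u S (a : Pt m) < τ := ha
  replace hb : τ ≤ height T ε w u S (b : Pt m) := not_lt.1 hb
  have han : Near ε w u a := by
    by_contra hn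
    rcases height_of_not_near (T := T) (S := S) hn with ⟨e, -⟩ | ⟨e, -⟩
    · linarith
    · exact M.not_between_height hW hab h hS hw (by linarith) (by linarith)
  have hbn : Near ε w u b := by
    by_contra hn
    rcases height_of_not_near (T := T) (S := S) hn with ⟨e, -⟩ | ⟨e, -⟩
    · exact M.not_between_height hW hab h hS hu (by linarith) (by linarith)
    · linarith
  rw [height_of_near han] at ha
  rw [height_of_near hbn] at hb
  refine ⟨a, b, hab, ?_⟩
  rw [hπ w u a h han, hπ w u b h hbn, ← image_segment]
  refine ⟨σ, ?_, rfl⟩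
  have h1 : edgeRatio P w u a ≤ σ := by
    rw [edgeRatio, div_le_iff₀ hlt]; linarith
  have h2 : σ ≤ edgeRatio P w u b := by
    rw [edgeRatio, le_div_iff₀ hlt]; linarith
  rw [segment_eq_Icc (h1.trans h2)]
  exact ⟨h1, h2⟩

/-- Placed on `T`, the spanning tree is a subdivision of `T`. -/
lemma edgeUnion_placement (hW : IsMST (pathDistOn G hDC) W) : edgeUnion W π = drawing T := by
  rw [drawing_eq_edgeUnion M.exists_adj]
  apply Set.Subset.antisymm
  · rintro x ⟨a, b, hab, hx⟩
    obtain ⟨w, u, h, ha, hb⟩ := M.exists_near_near hW hab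
    exact ⟨w, u, h, (convex_segment (w : Pt m) (u : Pt m)).segment_subset
      (M.placement_mem_segment hP hπ h ha) (M.placement_mem_segment hP hπ h hb) hx⟩
  · rintro x ⟨w, u, h, hx⟩
    exact M.segment_subset_edgeUnion hP hπ hW h hx

end

end

lemma nonempty_homeomorph_drawing (hW : IsMST (pathDistOn G hDC) W) :
    Nonempty (drawing W ≃ₜ drawing T) := by
  choose P hP using M.exists_mark
  obtain ⟨π, hπ⟩ := M.exists_placement hP
  have := M.nontrivial
  rw [drawing_eq_edgeUnion hW.1.connected.preconnected.exists_adj_of_nontrivial,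
    ← M.edgeUnion_placement hP hπ hW]
  exact nonempty_homeomorph_edgeUnion (M.isEmbeddedBy_coe hW) (M.isEmbeddedBy_placement hP hπ hW)

end IsSparseModel

end Placement

end SLGraph

end

theorem mainTheorem1 (m : ℕ) (ε γ δ : ℝ)
    -- the straight-line tree `T`, with at least one edge
    (V : Finset (SLGraph.Pt m)) (T : SimpleGraph V)
    (hT : SLGraph.IsStraightLineTree T) (hV : 2 ≤ V.card)
    -- the `ε`-sample `C` and the `γ`-approximation `G`
    (C : Finset (SLGraph.Pt m)) (hC : SLGraph.IsSample T C ε)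
    (G : SimpleGraph C) (hγ : 1 ≤ γ) (hG : SLGraph.IsApproximation T ε γ G)
    -- the `δ`-sparse subset `D`
    (D : Finset (SLGraph.Pt m)) (hDC : D ⊆ C)
    (hD : SLGraph.IsSparse (SLGraph.pathDistOn G hDC) δ)
    (hVD : (V : Set (SLGraph.Pt m)) ⊆ SLGraph.offset (D : Set (SLGraph.Pt m)) ε)
    -- no point of `D` is `ε`-close to both endpoints of an edge of `T`
    (hsep : ∀ u v : V, T.Adj u v → ∀ p ∈ D,
      ¬ (dist p (u : SLGraph.Pt m) ≤ ε ∧ dist p (v : SLGraph.Pt m) ≤ ε))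
    (hδ : 2 * γ * (ε + ε / Real.sin (SLGraph.minAngle T / 2)
      + SLGraph.maxEdgeLength G / Real.sin (min (SLGraph.minAngle T) (Real.pi / 2))) ≤ δ) :
    (∃ W : SimpleGraph D, SLGraph.IsMST (SLGraph.pathDistOn G hDC) W) ∧
    ∀ W : SimpleGraph D, SLGraph.IsMST (SLGraph.pathDistOn G hDC) W →
      Nonempty (SLGraph.drawing W ≃ₜ SLGraph.drawing T) := by
  have M : SLGraph.IsSparseModel ε γ δ T G hDC :=
    ⟨hT, hV, hC, hγ, hG, hD, hVD, hsep, by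
      rw [SLGraph.cornerRadius, ← add_assoc]; exact hδ⟩
  have := M.nontrivial
  exact ⟨SLGraph.exists_isMST _, fun W hW => M.nonempty_homeomorph_drawing hW⟩
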